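/- Let $n\ge 1$, $1<p<\infty$, $0<\kappa<1$, $0<\gamma<n$ and $p'=p/(p-1)$. Functions $f$ and $b$ on $\mathbb R^n$ are real- or complex-valued. Cubes $Q\subset\mathbb R^n$ have sides parallel to the axes and positive side length. A weight is a non-negative locally integrable function $w$ on $\mathbb R^n$, and $w(E)=\int_E w\,dx$. We write $w\in A_\infty$ if for some $1<q<\infty$, with $q'=q/(q-1)$, $$\sup_Q\Big(\frac1{|Q|}\int_Q w\,dx\Big)^{1/q}\Big(\frac1{|Q|}\int_Q w^{-q'/q}\,dx\Big)^{1/q'}<\infty .$$ $b\in\mathrm{BMO}(\mathbb R^n)$ means that $b$ is locally integrable and $\sup_Q\frac1{|Q|}\int_Q|b-b_Q|\,dx<\infty$, where $b_Q=\frac1{|Q|}\int_Q b$. For weights $w,\nu$ let $$\|f\|_{L^{p,\kappa}(\nu,w)}=\sup_Q\Big(\frac1{w(Q)^\kappa}\int_Q|f|^p\nu\,dx\Big)^{1/p},\qquad \|g\|_{WL^{p,\kappa}(w)}=\sup_Q\sup_{\sigma>0}\frac{\sigma}{w(Q)^{\kappa/p}}\,w\big(\{x\in Q:|g(x)|>\sigma\}\big)^{1/p};$$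 $L^{p,\kappa}(\nu,w)$ is the space of functions $f\in L^p_{loc}(\nu)$ for which the first quantity is finite, and $WL^{p,\kappa}(w)$ is the set of measurable $g$ for which the second one is finite. For $\mathcal A(t)=t^{p'}[\log(e+t)]^{p'}$ let $$\|h\|_{\mathcal A,Q}=\inf\Big\{\lambda>0:\frac1{|Q|}\int_Q\mathcal A\big(|h(x)|/\lambda\big)\,dx\le1\Big\}$$ (here $\nu^{-1/p}=\infty$ and $\mathcal A(\infty)=\infty$ where $\nu=0$; $\inf\emptyset=\infty$). Let $b\in\mathrm{BMO}(\mathbb R^n)$, let $w\in A_\infty$ and $\nu$ be weights, and suppose that for some $r>1$ and some $C<\infty$, for all cubes $Q$, $$|Q|^{\gamma/n}\Big(\frac1{|Q|}\int_Q w^r\,dx\Big)^{1/(rp)}\big\|\nu^{-1/p}\big\|_{\mathcal A,Q}\le C .$$ Let $[b,\mathcal T_\gamma]$ be a linear or sublinear operator, defined on a linear space $D$ of functions with $L^{p,\kappa}(\nu,w)\subseteq D$, and with measurable functions as values; sublinear means that, almost everywhere, $|[b,\mathcal T_\gamma](f+g)|\le|[b,\mathcal T_\gamma](f)|+|[b,\mathcal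 T_\gamma](g)|$ and $|[b,\mathcal T_\gamma](cf)|=|c|\,|[b,\mathcal T_\gamma](f)|$ for $f,g\in D$ and scalars $c$. Suppose that: (i) there is a constant $c_4$ such that $$\big|[b,\mathcal T_\gamma](f)(x)\big|\le c_4\int_{\mathbb R^n}\frac{|b(x)-b(y)|\,|f(y)|}{|x-y|^{n-\gamma}}\,dy\qquad\text{for almost every }x\notin\operatorname{supp}f,$$ for every $f\in D$ which is in $L^1(\mathbb R^n)$ with compact support, and for every $f\in L^{p,\kappa}(\nu,w)$; (ii) there is a constant $C$ such that for all $f\in D$ and all $\sigma>0$, $$w\big(\{x\in\mathbb R^n:|[b,\mathcal T_\gamma](f)(x)|>\sigma\}\big)\le\frac{C}{\sigma^p}\int_{\mathbb R^n}|f(x)|^p\nu(x)\,dx .$$ Then $[b,\mathcal T_\gamma]$ is bounded from $L^{p,\kappa}(\nu,w)$ into $WL^{p,\kappa}(w)$: there is a constant $C$ such that for all $f\in L^{p,\kappa}(\nu,w)$ one has $[b,\mathcal T_\gamma](f)\in WL^{p,\kappa}(w)$ and $\|[b,\mathcal T_\gamma](f)\|_{WL^{p,\kappa}(w)}\le C\|f\|_{L^{p,\kappa}(\nu,w)}$.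 -/

import Mathlib

open MeasureTheory Set
open scoped ENNReal NNReal

noncomputable section

namespace WeightedMorrey

/-- The closed cube `Q(x, ℓ)` with centre `x`, side length `ℓ` and sides parallel to the axes. -/
def cube {n : ℕ} (x : EuclideanSpace ℝ (Fin n)) (ℓ : ℝ) : Set (EuclideanSpace ℝ (Fin n)) :=
  {y | ∀ i, |y i - x i| ≤ ℓ / 2}

/-- A weight: a non-negative, locally integrable function. -/
structure IsWeight {n : ℕ} (w : EuclideanSpace ℝ (Fin n) → ℝ) : Prop where
  nonneg : ∀ x, 0 ≤ w x
  locallyIntegrable : LocallyIntegrable w volume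

/-- The measure `w(E) = ∫_E w(x) dx`. -/
def wMeasure {n : ℕ} (w : EuclideanSpace ℝ (Fin n) → ℝ) :
    Measure (EuclideanSpace ℝ (Fin n)) :=
  volume.withDensity (fun x => ENNReal.ofReal (w x))

/-- The mean `|Q|⁻¹ ∫_Q g` of a function with values in `[0, ∞]`. -/
def mean {n : ℕ} (Q : Set (EuclideanSpace ℝ (Fin n)))
    (g : EuclideanSpace ℝ (Fin n) → ℝ≥0∞) : ℝ≥0∞ :=
  (volume Q)⁻¹ * ∫⁻ x in Q, g x

/-- The Muckenhoupt class `A_q`, `1 < q < ∞`. Powers are taken in `[0, ∞]`, so that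
`w(x) ^ (-q'/q) = ∞` where `w(x) = 0`. -/
def MemAp {n : ℕ} (q : ℝ) (w : EuclideanSpace ℝ (Fin n) → ℝ) : Prop :=
  IsWeight w ∧ ∃ C : ℝ≥0, ∀ (x : EuclideanSpace ℝ (Fin n)) (ℓ : ℝ), 0 < ℓ →
    mean (cube x ℓ) (fun y => ENNReal.ofReal (w y)) ^ (1 / q)
      * mean (cube x ℓ) (fun y => ENNReal.ofReal (w y) ^ (-(q.conjExponent / q)))
          ^ (1 / q.conjExponent) ≤ C

/-- The class `A_∞`, the union of the classes `A_q`, `1 < q < ∞`. -/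
def MemAInfty {n : ℕ} (w : EuclideanSpace ℝ (Fin n) → ℝ) : Prop :=
  ∃ q : ℝ, 1 < q ∧ MemAp q w

/-- The John–Nirenberg seminorm `‖b‖_*`. -/
def bmoSeminorm {n : ℕ} {𝕜 : Type*} [RCLike 𝕜] (b : EuclideanSpace ℝ (Fin n) → 𝕜) : ℝ≥0∞ :=
  ⨆ (x : EuclideanSpace ℝ (Fin n)) (ℓ : ℝ) (_ : 0 < ℓ),
    mean (cube x ℓ) (fun y => ‖b y - ⨍ z in cube x ℓ, b z‖ₑ)

/-- `b ∈ BMO(ℝⁿ)`. -/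
def MemBMO {n : ℕ} {𝕜 : Type*} [RCLike 𝕜] (b : EuclideanSpace ℝ (Fin n) → 𝕜) : Prop :=
  LocallyIntegrable b volume ∧ bmoSeminorm b < ∞

/-- The function `t ↦ t ^ s * (log (e + t)) ^ s` on `[0, ∞]`, with value `∞` at `t = ∞`. -/
def logBump (s : ℝ) (t : ℝ≥0∞) : ℝ≥0∞ :=
  if t = ∞ then ∞
  else ENNReal.ofReal (t.toReal ^ s * Real.log (Real.exp 1 + t.toReal) ^ s)

/-- The Luxemburg norm `‖g‖_{Φ,Q} = inf {t > 0 : |Q|⁻¹ ∫_Q Φ(g(x)/t) dx ≤ 1}` of a function with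
values in `[0, ∞]`; it is `∞` if there is no such `t`. -/
def luxemburgNorm {n : ℕ} (Φ : ℝ≥0∞ → ℝ≥0∞) (Q : Set (EuclideanSpace ℝ (Fin n)))
    (g : EuclideanSpace ℝ (Fin n) → ℝ≥0∞) : ℝ≥0∞ :=
  sInf {t : ℝ≥0∞ | 0 < t ∧ t < ∞ ∧ mean Q (fun x => Φ (g x / t)) ≤ 1}

/-- The bump condition with exponent `r`: for some finite `C` and all cubes `Q`,
`|Q| ^ (γ/n) * (|Q|⁻¹ ∫_Q w ^ r) ^ (1/(rp)) * ‖ν ^ (-1/p)‖_{A,Q} ≤ C`, where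
`A(t) = t ^ p' * (log (e + t)) ^ p'`. Here `ν(x) ^ (-1/p) = ∞` where `ν(x) = 0`. -/
def FracBump {n : ℕ} (γ p r : ℝ) (w ν : EuclideanSpace ℝ (Fin n) → ℝ) : Prop :=
  ∃ C : ℝ≥0, ∀ (x : EuclideanSpace ℝ (Fin n)) (ℓ : ℝ), 0 < ℓ →
    volume (cube x ℓ) ^ (γ / n)
      * mean (cube x ℓ) (fun y => ENNReal.ofReal (w y) ^ r) ^ (1 / (r * p))
      * luxemburgNorm (logBump p.conjExponent) (cube x ℓ)
          (fun y => ENNReal.ofReal (ν y) ^ (-(1 / p))) ≤ C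

/-- The norm of the weighted Morrey space `L^{p,κ}(ν,w)`. -/
def morreyNorm {n : ℕ} {𝕜 : Type*} [RCLike 𝕜] (p κ : ℝ) (ν w : EuclideanSpace ℝ (Fin n) → ℝ)
    (f : EuclideanSpace ℝ (Fin n) → 𝕜) : ℝ≥0∞ :=
  ⨆ (x : EuclideanSpace ℝ (Fin n)) (ℓ : ℝ) (_ : 0 < ℓ),
    ((wMeasure w (cube x ℓ) ^ κ)⁻¹
      * ∫⁻ y in cube x ℓ, ‖f y‖ₑ ^ p * ENNReal.ofReal (ν y)) ^ (1 / p)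

/-- `f ∈ L^{p,κ}(ν,w)`. -/
structure MemMorrey {n : ℕ} {𝕜 : Type*} [RCLike 𝕜] (p κ : ℝ)
    (ν w : EuclideanSpace ℝ (Fin n) → ℝ) (f : EuclideanSpace ℝ (Fin n) → 𝕜) : Prop where
  aestronglyMeasurable : AEStronglyMeasurable f volume
  locally_lt_top : ∀ K : Set (EuclideanSpace ℝ (Fin n)), IsCompact K →
    ∫⁻ y in K, ‖f y‖ₑ ^ p * ENNReal.ofReal (ν y) < ∞
  norm_lt_top : morreyNorm p κ ν w f < ∞

/-- The (quasi-)norm of the weighted weak Morrey space `WL^{p,κ}(w)`. -/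
def weakMorreyNorm {n : ℕ} {𝕜 : Type*} [RCLike 𝕜] (p κ : ℝ) (w : EuclideanSpace ℝ (Fin n) → ℝ)
    (f : EuclideanSpace ℝ (Fin n) → 𝕜) : ℝ≥0∞ :=
  ⨆ (x : EuclideanSpace ℝ (Fin n)) (ℓ : ℝ) (_ : 0 < ℓ) (σ : ℝ) (_ : 0 < σ),
    (wMeasure w (cube x ℓ) ^ (κ / p))⁻¹ * ENNReal.ofReal σ
      * wMeasure w {y | y ∈ cube x ℓ ∧ σ < ‖f y‖} ^ (1 / p)

/-- `f ∈ WL^{p,κ}(w)`. -/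
structure MemWeakMorrey {n : ℕ} {𝕜 : Type*} [RCLike 𝕜] (p κ : ℝ)
    (w : EuclideanSpace ℝ (Fin n) → ℝ) (f : EuclideanSpace ℝ (Fin n) → 𝕜) : Prop where
  aestronglyMeasurable : AEStronglyMeasurable f volume
  norm_lt_top : weakMorreyNorm p κ w f < ∞

/-- `T` is a linear or sublinear operator with domain the linear space `D`, with measurable
functions as values. Nothing is said about `T f` for `f ∉ D`. -/
structure IsSublinearOn {n : ℕ} {𝕜 : Type*} [RCLike 𝕜]
    (D : Submodule 𝕜 (EuclideanSpace ℝ (Fin n) → 𝕜))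
    (T : (EuclideanSpace ℝ (Fin n) → 𝕜) → EuclideanSpace ℝ (Fin n) → 𝕜) : Prop where
  aestronglyMeasurable : ∀ f ∈ D, AEStronglyMeasurable (T f) volume
  add_le : ∀ f ∈ D, ∀ g ∈ D, ∀ᵐ x, ‖T (f + g) x‖ ≤ ‖T f x‖ + ‖T g x‖
  smul_eq : ∀ (c : 𝕜), ∀ f ∈ D, ∀ᵐ x, ‖T (c • f) x‖ = ‖c‖ * ‖T f x‖

/-- The size condition
`|T f(x)| ≤ c ∫ |b(x) - b(y)| |f(y)| / |x - y| ^ (n - γ) dy` for almost every `x ∉ supp f`,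
for all `f` in the class `S`, with `c` independent of `f` and `x`. It is vacuous at the points
where the integral is infinite. -/
def FracCommutatorSize {n : ℕ} {𝕜 : Type*} [RCLike 𝕜] (γ : ℝ)
    (b : EuclideanSpace ℝ (Fin n) → 𝕜)
    (T : (EuclideanSpace ℝ (Fin n) → 𝕜) → EuclideanSpace ℝ (Fin n) → 𝕜)
    (S : Set (EuclideanSpace ℝ (Fin n) → 𝕜)) : Prop :=
  ∃ c : ℝ≥0, ∀ f ∈ S, ∀ᵐ x, x ∉ tsupport f →
    ‖T f x‖ₑ ≤ c * ∫⁻ y, ‖b x - b y‖ₑ * ‖f y‖ₑ / ‖x - y‖ₑ ^ ((n : ℝ) - γ)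

/-- The two-weight weak-type `(p,p)` inequality
`w({|T f| > σ}) ≤ C σ ^ (-p) ∫ |f| ^ p ν` for all `f ∈ D` and `σ > 0`. -/
def WeakTypeOn {n : ℕ} {𝕜 : Type*} [RCLike 𝕜] (p : ℝ) (w ν : EuclideanSpace ℝ (Fin n) → ℝ)
    (D : Submodule 𝕜 (EuclideanSpace ℝ (Fin n) → 𝕜))
    (T : (EuclideanSpace ℝ (Fin n) → 𝕜) → EuclideanSpace ℝ (Fin n) → 𝕜) : Prop :=
  ∃ C : ℝ≥0, ∀ f ∈ D, ∀ σ : ℝ, 0 < σ →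
    wMeasure w {x | σ < ‖T f x‖}
      ≤ C / ENNReal.ofReal σ ^ p * ∫⁻ x, ‖f x‖ₑ ^ p * ENNReal.ofReal (ν x)

end WeightedMorrey

end

open WeightedMorrey

/-! Fix a cube `Q` and split `f = f₁ + f₂` with `f₁` the restriction of `f` to `2Q`. The weak-type
hypothesis applied to `f₁`, together with the Morrey bound on `2Q` and doubling of `w`, gives the
right power `w(Q)^κ`. For `f₂` there is a pointwise bound on `Q`, namely `C ‖f‖ w(Q)^((κ-1)/p) (|b -
b_Q| + 1)`. Chebyshev's inequality finishes the proof, since `(|b - b_Q| + 1)^p` has bounded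
`w`-average over `Q`.

The pointwise bound (`exists_lintegral_fractional_commutator_le`) comes from summing over the
dilates `2^m Q`. There `|b(x) - b(y)|` is at most `|b(x) - b_Q|`, plus a multiple of `m`, plus the
oscillation of `b` on `2^m Q`. Hölder's inequality against `ν^(1/p) ν^(-1/p)` isolates the factor
`ν^(-1/p)` times the oscillation; as the oscillation is exponentially integrable, the logarithmic
bump absorbs it. The bump condition then turns the `m`-th term into `m w(2^m Q)^((κ-1)/p)`, up to
constants, and since `κ < 1` reverse doubling of `w` makes the series converge.

All that is used of `A_∞`, once the zero weight is set aside, is doubling and `HalvingBound`. The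
latter gives both reverse doubling and, through the Calderón–Zygmund decomposition, a John–Nirenberg
inequality. That inequality is proved once for a general measure, then used for Lebesgue measure (in
the Hölder step) and for `w` (in the Chebyshev step). -/

open WeightedMorrey Filter Topology

namespace WeightedMorrey

/-! ### Cubes: volume, averages, Lebesgue differentiation, separation. -/

section CubeGeometry

variable {n : ℕ}

theorem cube_eq_preimage_closedBall (x : EuclideanSpace ℝ (Fin n)) {ℓ : ℝ} (hℓ : 0 ≤ ℓ) :
    cube x ℓ = (WithLp.ofLp) ⁻¹' (Metric.closedBall (WithLp.ofLp x) (ℓ / 2)) := by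
  ext y
  simp only [cube, mem_ofPred_eq, mem_preimage, Metric.mem_closedBall]
  rw [dist_pi_le_iff (by positivity)]
  simp [Real.dist_eq]

theorem isClosed_cube (x : EuclideanSpace ℝ (Fin n)) (ℓ : ℝ) : IsClosed (cube x ℓ) := by
  have : cube x ℓ = ⋂ i, {y | |y i - x i| ≤ ℓ / 2} := by ext; simp [cube]
  rw [this]
  exact isClosed_iInter fun i => isClosed_le (by fun_prop) continuous_const

theorem measurableSet_cube (x : EuclideanSpace ℝ (Fin n)) (ℓ : ℝ) : MeasurableSet (cube x ℓ) :=
  (isClosed_cube x ℓ).measurableSet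

theorem volume_cube (x : EuclideanSpace ℝ (Fin n)) {ℓ : ℝ} (hℓ : 0 ≤ ℓ) :
    volume (cube x ℓ) = ENNReal.ofReal ℓ ^ n := by
  rw [cube_eq_preimage_closedBall x hℓ,
    (PiLp.volume_preserving_ofLp (Fin n)).measure_preimage
      Metric.isClosed_closedBall.measurableSet.nullMeasurableSet,
    Real.volume_pi_closedBall _ (by positivity), ENNReal.ofReal_pow (by positivity)]
  simp [mul_div_cancel₀]

theorem volume_cube_ne_top (x : EuclideanSpace ℝ (Fin n)) {ℓ : ℝ} (hℓ : 0 ≤ ℓ) :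
    volume (cube x ℓ) ≠ ∞ := by
  rw [volume_cube x hℓ]; exact ENNReal.pow_ne_top ENNReal.ofReal_ne_top

theorem volume_cube_ne_zero (x : EuclideanSpace ℝ (Fin n)) {ℓ : ℝ} (hℓ : 0 < ℓ) :
    volume (cube x ℓ) ≠ 0 := by
  rw [volume_cube x hℓ.le]; exact pow_ne_zero _ (by simpa using hℓ)

theorem volume_cube_two_mul (x : EuclideanSpace ℝ (Fin n)) {ℓ : ℝ} (hℓ : 0 ≤ ℓ) :
    volume (cube x (2 * ℓ)) = 2 ^ n * volume (cube x ℓ) := by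
  rw [volume_cube x hℓ, volume_cube x (by positivity), ENNReal.ofReal_mul (by norm_num), mul_pow]
  simp

theorem isCompact_cube (x : EuclideanSpace ℝ (Fin n)) (ℓ : ℝ) : IsCompact (cube x ℓ) := by
  rcases le_or_gt 0 ℓ with hℓ | hℓ
  · have h := (PiLp.homeomorph 2 (fun _ : Fin n => ℝ)).isCompact_preimage.2
      (isCompact_closedBall (WithLp.ofLp x) (ℓ / 2))
    rw [cube_eq_preimage_closedBall x hℓ]
    exact h
  · rcases isEmpty_or_nonempty (Fin n) with hn | ⟨⟨i⟩⟩
    · exact (Set.toFinite _).isCompact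
    · have : cube x ℓ = ∅ := by
        ext y
        simp only [cube, mem_ofPred_eq, mem_empty_iff_false, iff_false, not_forall]
        exact ⟨i, by have := abs_nonneg (y i - x i); linarith⟩
      rw [this]; exact isCompact_empty

theorem cube_subset_cube (x : EuclideanSpace ℝ (Fin n)) {ℓ ℓ' : ℝ} (h : ℓ ≤ ℓ') :
    cube x ℓ ⊆ cube x ℓ' := fun y hy i => (hy i).trans (by linarith)

theorem enorm_setAverage_le_mean {𝕜 : Type*} [RCLike 𝕜] (Q : Set (EuclideanSpace ℝ (Fin n)))
    (h : EuclideanSpace ℝ (Fin n) → 𝕜) (hQ0 : volume Q ≠ 0)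
    (hQ : volume Q ≠ ∞) : ‖⨍ z in Q, h z‖ₑ ≤ mean Q (fun z => ‖h z‖ₑ) := by
  rw [setAverage_eq, enorm_smul, mean]
  gcongr
  · have hr : volume.real Q ≠ 0 := ENNReal.toReal_ne_zero.2 ⟨hQ0, hQ⟩
    rw [enorm_inv hr, measureReal_def, Real.enorm_eq_ofReal ENNReal.toReal_nonneg,
      ENNReal.ofReal_toReal hQ]
  · exact enorm_integral_le_lintegral_enorm _

theorem mean_mono {Q : Set (EuclideanSpace ℝ (Fin n))} {g h : EuclideanSpace ℝ (Fin n) → ℝ≥0∞}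
    (hgh : ∀ x, g x ≤ h x) : mean Q g ≤ mean Q h := by
  unfold mean
  gcongr
  exact hgh _

theorem locallyIntegrable_comp_toLp {𝕜 : Type*} [RCLike 𝕜] {h : EuclideanSpace ℝ (Fin n) → 𝕜}
    (hh : LocallyIntegrable h volume) :
    LocallyIntegrable (fun y : Fin n → ℝ => h (WithLp.toLp 2 y)) volume := by
  rw [locallyIntegrable_iff] at hh ⊢
  intro K hK
  have hK' : IsCompact (WithLp.ofLp (p := 2) ⁻¹' K) :=
    (PiLp.homeomorph 2 (fun _ : Fin n => ℝ)).isCompact_preimage.2 hK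
  exact ((PiLp.volume_preserving_toLp (Fin n)).integrableOn_comp_preimage
    (MeasurableEquiv.toLp 2 _).measurableEmbedding).2 (hh _ hK')

/-- Lebesgue differentiation along cubes that contain `y` but need not be centred there. Cubes are
balls for the sup norm, so the differentiation theorem for doubling measures is applied on `Fin n →
ℝ` and transported back. The exceptional null set does not depend on the sequence of cubes. -/
theorem ae_enorm_le_of_mean_cube_le {𝕜 : Type*} [RCLike 𝕜] {h : EuclideanSpace ℝ (Fin n) → 𝕜}
    (hh : LocallyIntegrable h volume) (s : ℝ≥0∞) :
    ∀ᵐ y, ∀ (c : ℕ → EuclideanSpace ℝ (Fin n)) (ℓ : ℕ → ℝ), Tendsto ℓ atTop (𝓝[>] 0) →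
      (∀ k, 0 < ℓ k) → (∀ k, y ∈ cube (c k) (ℓ k)) →
      (∀ k, mean (cube (c k) (ℓ k)) (fun z => ‖h z‖ₑ) ≤ s) → ‖h y‖ₑ ≤ s := by
  have key := IsUnifLocDoublingMeasure.ae_tendsto_average (volume : Measure (Fin n → ℝ))
    (locallyIntegrable_comp_toLp hh) 1
  have key' := (PiLp.volume_preserving_ofLp (Fin n)).quasiMeasurePreserving.ae key
  filter_upwards [key'] with y hy c ℓ hℓ hℓ0 hyc hm
  have h1 := hy (fun k => WithLp.ofLp (c k)) (fun k => ℓ k / 2) (l := atTop) (by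
    rw [tendsto_nhdsWithin_iff] at hℓ ⊢
    refine ⟨by simpa using hℓ.1.div_const 2, ?_⟩
    filter_upwards with k
    exact half_pos (hℓ0 k)) (by
    filter_upwards with k
    have := hyc k
    rw [cube_eq_preimage_closedBall _ (hℓ0 k).le] at this
    simpa using this)
  have h2 : ∀ k, ⨍ z in Metric.closedBall (WithLp.ofLp (c k)) (ℓ k / 2), h (WithLp.toLp 2 z) =
      ⨍ z in cube (c k) (ℓ k), h z := by
    intro k
    rw [setAverage_eq, setAverage_eq, measureReal_def, measureReal_def,
      cube_eq_preimage_closedBall _ (hℓ0 k).le,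
      ← (PiLp.volume_preserving_ofLp (Fin n)).setIntegral_preimage_emb
      (MeasurableEquiv.toLp 2 (Fin n → ℝ)).symm.measurableEmbedding,
      (PiLp.volume_preserving_ofLp (Fin n)).measure_preimage
      Metric.isClosed_closedBall.measurableSet.nullMeasurableSet]
  simp only [h2] at h1
  refine le_of_tendsto (h1.enorm) ?_
  filter_upwards with k
  exact (enorm_setAverage_le_mean _ _ (volume_cube_ne_zero _ (hℓ0 k))
    (volume_cube_ne_top _ (hℓ0 k).le)).trans (hm k)

/-- A point within `cube x ℓ` stays at distance at least `r / 4` from points outside `cube x r`. -/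
theorem le_norm_sub_of_mem_cube {x y z : EuclideanSpace ℝ (Fin n)} {ℓ r : ℝ} (hr : 2 * ℓ ≤ r)
    (hy : y ∈ cube x ℓ) (hz : z ∉ cube x r) : r / 4 ≤ ‖y - z‖ := by
  simp only [cube, mem_ofPred_eq, not_forall, not_le] at hz
  obtain ⟨i, hi⟩ := hz
  have h1 := PiLp.norm_apply_le (y - z) i
  have h2 := hy i
  have h3 : |z i - x i| ≤ |y i - x i| + ‖(y - z) i‖ := by
    rw [PiLp.sub_apply, Real.norm_eq_abs, abs_sub_comm (y i) (z i)]
    have := abs_sub_le (z i) (y i) (x i)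
    linarith
  linarith

/-- The size condition is available only off the closed support; the strict inequality `ℓ < r`
leaves an open neighbourhood of the small cube on which the function vanishes. -/
theorem notMem_tsupport_indicator_compl_cube {𝕜 : Type*} [RCLike 𝕜]
    (f : EuclideanSpace ℝ (Fin n) → 𝕜) {x y : EuclideanSpace ℝ (Fin n)} {ℓ r : ℝ}
    (hr : ℓ < r) (hy : y ∈ cube x ℓ) : y ∉ tsupport ((cube x r)ᶜ.indicator f) := by
  have hU : IsOpen {y : EuclideanSpace ℝ (Fin n) | ∀ i, |y i - x i| < r / 2} := by
    simp only [ofPred_forall]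
    exact isOpen_iInter_of_finite fun i => isOpen_lt (by fun_prop) continuous_const
  rw [notMem_tsupport_iff_eventuallyEq]
  filter_upwards [hU.mem_nhds (show y ∈ _ from fun i => (hy i).trans_lt (by linarith))] with z hz
  simp only [Pi.zero_apply, indicator_apply_eq_zero, mem_compl_iff]
  exact fun h => absurd (fun i => (hz i).le) h

end CubeGeometry

/-! ### Dyadic subcells of a cube and the Calderón–Zygmund decomposition. -/

section DyadicGrid

variable {n : ℕ}

/-- The index of the dyadic subcell of generation `k` of the cube `Q(x, ℓ)` that contains `y`. -/
noncomputable def gridIndex (x : EuclideanSpace ℝ (Fin n)) (ℓ : ℝ) (k : ℕ)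
    (y : EuclideanSpace ℝ (Fin n)) : Fin n → ℤ := fun i => ⌊2 ^ k * ((y i - x i) / ℓ + 1 / 2)⌋

/-- The half-open dyadic subcell of generation `k` and index `m` of the cube `Q(x, ℓ)`. -/
def gridCell (x : EuclideanSpace ℝ (Fin n)) (ℓ : ℝ) (k : ℕ) (m : Fin n → ℤ) :
    Set (EuclideanSpace ℝ (Fin n)) := {y | gridIndex x ℓ k y = m}

/-- The centre of `gridCell x ℓ k m`. -/
noncomputable def gridCenter (x : EuclideanSpace ℝ (Fin n)) (ℓ : ℝ) (k : ℕ) (m : Fin n → ℤ) :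
    EuclideanSpace ℝ (Fin n) :=
  WithLp.toLp 2 fun i => x i + ℓ * ((m i + 1 / 2) / 2 ^ k - 1 / 2)

theorem gridCell_eq_preimage (x : EuclideanSpace ℝ (Fin n)) {ℓ : ℝ} (hℓ : 0 < ℓ) (k : ℕ)
    (m : Fin n → ℤ) : gridCell x ℓ k m = WithLp.ofLp ⁻¹' (univ.pi fun i =>
      Ico (gridCenter x ℓ k m i - ℓ / 2 ^ k / 2) (gridCenter x ℓ k m i + ℓ / 2 ^ k / 2)) := by
  ext y
  simp only [gridCell, gridIndex, mem_ofPred_eq, funext_iff, Int.floor_eq_iff, mem_preimage,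
    Set.mem_pi, mem_univ, true_imp_iff, mem_Ico, gridCenter]
  refine forall_congr' fun i => ?_
  have h2 : (0 : ℝ) < 2 ^ k := by positivity
  have e : y i = x i + ℓ * ((2 ^ k * ((y i - x i) / ℓ + 1 / 2)) / 2 ^ k - 1 / 2) := by
    field_simp; ring
  generalize 2 ^ k * ((y i - x i) / ℓ + 1 / 2) = t at e
  have e1 : x i + ℓ * (((m i : ℝ) + 1 / 2) / 2 ^ k - 1 / 2) - ℓ / 2 ^ k / 2
      = x i + ℓ * ((m i : ℝ) / 2 ^ k - 1 / 2) := by ring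
  have e2 : x i + ℓ * (((m i : ℝ) + 1 / 2) / 2 ^ k - 1 / 2) + ℓ / 2 ^ k / 2
      = x i + ℓ * (((m i : ℝ) + 1) / 2 ^ k - 1 / 2) := by ring
  rw [e1, e2, e, add_le_add_iff_left, add_lt_add_iff_left, mul_le_mul_iff_right₀ hℓ,
    mul_lt_mul_iff_right₀ hℓ, sub_le_sub_iff_right, sub_lt_sub_iff_right,
    div_le_div_iff_of_pos_right h2, div_lt_div_iff_of_pos_right h2]

theorem cube_eq_preimage_Icc (x : EuclideanSpace ℝ (Fin n)) (ℓ : ℝ) :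
    cube x ℓ = WithLp.ofLp ⁻¹' (Icc (fun i => x i - ℓ / 2) (fun i => x i + ℓ / 2)) := by
  ext y
  simp only [cube, mem_ofPred_eq, mem_preimage, mem_Icc, Pi.le_def, ← forall_and, abs_le]
  exact forall_congr' fun i => ⟨fun h => ⟨by linarith, by linarith⟩,
    fun h => ⟨by linarith, by linarith⟩⟩

/-- Half-open cells partition space exactly, whereas averages and `BMO` refer to closed cubes. The
two differ by a null boundary, so averages may be exchanged. -/
theorem gridCell_ae_eq_cube (x : EuclideanSpace ℝ (Fin n)) {ℓ : ℝ} (hℓ : 0 < ℓ) (k : ℕ)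
    (m : Fin n → ℤ) : gridCell x ℓ k m =ᵐ[volume] cube (gridCenter x ℓ k m) (ℓ / 2 ^ k) := by
  rw [gridCell_eq_preimage x hℓ, cube_eq_preimage_Icc]
  exact (PiLp.volume_preserving_ofLp (Fin n)).quasiMeasurePreserving.preimage_ae_eq
    Measure.univ_pi_Ico_ae_eq_Icc

theorem gridCell_subset_cube (x : EuclideanSpace ℝ (Fin n)) {ℓ : ℝ} (hℓ : 0 < ℓ) (k : ℕ)
    (m : Fin n → ℤ) : gridCell x ℓ k m ⊆ cube (gridCenter x ℓ k m) (ℓ / 2 ^ k) := by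
  rw [gridCell_eq_preimage x hℓ, cube_eq_preimage_Icc]
  exact preimage_mono fun y hy =>
    ⟨fun i => (hy i (mem_univ i)).1, fun i => (hy i (mem_univ i)).2.le⟩

theorem gridCenter_zero (x : EuclideanSpace ℝ (Fin n)) (ℓ : ℝ) : gridCenter x ℓ 0 0 = x := by
  ext i; simp [gridCenter]

theorem measurable_gridIndex (x : EuclideanSpace ℝ (Fin n)) (ℓ : ℝ) (k : ℕ) :
    Measurable (gridIndex x ℓ k) := by
  refine measurable_pi_lambda _ fun i => ?_
  unfold gridIndex
  fun_prop

/-- Nestedness of the grid: the index of the parent cell is the integer quotient by 2 of the index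
of the child. -/
theorem gridIndex_eq_of_le (x : EuclideanSpace ℝ (Fin n)) (ℓ : ℝ) {j k : ℕ} (hjk : j ≤ k)
    {y z : EuclideanSpace ℝ (Fin n)} (h : gridIndex x ℓ k y = gridIndex x ℓ k z) :
    gridIndex x ℓ j y = gridIndex x ℓ j z := by
  induction k, hjk using Nat.le_induction with
  | base => exact h
  | succ k _ ih =>
    refine ih (funext fun i => ?_)
    have key : ∀ t : ℝ, ⌊2 ^ k * t⌋ = ⌊2 ^ (k + 1) * t⌋ / 2 := fun t => by
      have := Int.floor_div_natCast (2 ^ (k + 1) * t) 2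
      rw [show 2 ^ (k + 1) * t / ((2 : ℕ) : ℝ) = 2 ^ k * t by push_cast; ring] at this
      simpa using this
    have hi := congrFun h i
    simp only [gridIndex] at hi ⊢
    rw [key, key, hi]

theorem mean_congr_set {Q Q' : Set (EuclideanSpace ℝ (Fin n))} (h : Q =ᵐ[volume] Q')
    (g : EuclideanSpace ℝ (Fin n) → ℝ≥0∞) : mean Q g = mean Q' g := by
  unfold mean
  rw [measure_congr h, setLIntegral_congr h]

theorem mean_le_mul_mean {Q Q' : Set (EuclideanSpace ℝ (Fin n))} (h : Q ⊆ Q') {C : ℝ≥0∞}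
    (hC0 : C ≠ 0) (hC : C ≠ ∞) (hv : volume Q' = C * volume Q)
    (g : EuclideanSpace ℝ (Fin n) → ℝ≥0∞) : mean Q g ≤ C * mean Q' g := by
  unfold mean
  rw [hv, ENNReal.mul_inv (Or.inl hC0) (Or.inl hC), ← mul_assoc, ← mul_assoc,
    ENNReal.mul_inv_cancel hC0 hC, one_mul]
  gcongr

/-- The Calderón–Zygmund decomposition of a cube at height `s`. -/
theorem exists_calderonZygmund_decomposition {𝕜 : Type*} [RCLike 𝕜]
    {h : EuclideanSpace ℝ (Fin n) → 𝕜} (hh : LocallyIntegrable h volume)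
    (x : EuclideanSpace ℝ (Fin n)) {ℓ : ℝ} (hℓ : 0 < ℓ) {s : ℝ≥0∞}
    (hs : mean (cube x ℓ) (fun z => ‖h z‖ₑ) ≤ s) :
    ∃ (ι : Type) (_ : Countable ι) (c : ι → EuclideanSpace ℝ (Fin n)) (r : ι → ℝ)
      (R : ι → Set (EuclideanSpace ℝ (Fin n))),
      (∀ i, 0 < r i) ∧ (∀ i, MeasurableSet (R i)) ∧ Pairwise (Function.onFun Disjoint R) ∧
      (∀ i, R i ⊆ cube x ℓ) ∧ (∀ i, R i ⊆ cube (c i) (r i)) ∧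
      (∀ i, R i =ᵐ[volume] cube (c i) (r i)) ∧
      (∀ i, s < mean (cube (c i) (r i)) (fun z => ‖h z‖ₑ)) ∧
      (∀ i, mean (cube (c i) (r i)) (fun z => ‖h z‖ₑ) ≤ 2 ^ n * s) ∧
      ∀ᵐ y, y ∈ cube x ℓ → y ∉ ⋃ i, R i → ‖h y‖ₑ ≤ s := by
  classical
  set g : EuclideanSpace ℝ (Fin n) → ℝ≥0∞ := fun z => ‖h z‖ₑ with hg
  set bad : ℕ → EuclideanSpace ℝ (Fin n) → Prop :=
    fun k y => s < mean (gridCell x ℓ k (gridIndex x ℓ k y)) g with hbad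
  have hbad_congr : ∀ {j k : ℕ}, j ≤ k → ∀ {y z}, gridIndex x ℓ k y = gridIndex x ℓ k z →
      (bad j y ↔ bad j z) := fun hjk y z hyz => by
    simp only [hbad, gridIndex_eq_of_le x ℓ hjk hyz]
  have hbad_meas : ∀ k, MeasurableSet {y | bad k y} := fun k =>
    measurable_gridIndex x ℓ k
      ((Set.to_countable {m | s < mean (gridCell x ℓ k m) g}).measurableSet)
  have hcell_meas : ∀ k m, MeasurableSet (gridCell x ℓ k m) := fun k m =>
    measurable_gridIndex x ℓ k (measurableSet_singleton m)
  have hzero : gridCell x ℓ 0 0 ⊆ cube x ℓ := by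
    have := gridCell_subset_cube x hℓ 0 0
    rwa [gridCenter_zero, pow_zero, div_one] at this
  have hzero_ae : gridCell x ℓ 0 0 =ᵐ[volume] cube x ℓ := by
    have := gridCell_ae_eq_cube x hℓ 0 0
    rwa [gridCenter_zero, pow_zero, div_one] at this
  -- Stopping time: only the first generation whose cell has average above `s` is kept. This makes
  -- the selected cells disjoint and their parents good.
  set firstBad : ℕ → Set (EuclideanSpace ℝ (Fin n)) :=
    fun k => {y | y ∈ gridCell x ℓ 0 0 ∧ bad k y ∧ ∀ j < k, ¬ bad j y} with hfirst
  have hfirst_meas : ∀ k, MeasurableSet (firstBad k) := fun k => by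
    have : firstBad k = gridCell x ℓ 0 0 ∩ ({y | bad k y} ∩
        ⋂ j : ℕ, ⋂ _ : j < k, {y | bad j y}ᶜ) := by
      ext y
      simp only [hfirst, mem_ofPred_eq, mem_inter_iff, mem_iInter, mem_compl_iff]
    rw [this]
    exact (hcell_meas 0 0).inter ((hbad_meas k).inter (MeasurableSet.iInter fun j =>
      MeasurableSet.iInter fun _ => (hbad_meas j).compl))
  have hfirst_congr : ∀ {k : ℕ} {y z}, gridIndex x ℓ k y = gridIndex x ℓ k z →
      y ∈ firstBad k → z ∈ firstBad k := fun {k y z} hyz hy => by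
    refine ⟨?_, (hbad_congr le_rfl hyz).1 hy.2.1, fun j hj hb => hy.2.2 j hj
      ((hbad_congr hj.le hyz).2 hb)⟩
    have h0 := hy.1
    simp only [gridCell, mem_ofPred_eq] at h0 ⊢
    rw [← gridIndex_eq_of_le x ℓ (Nat.zero_le k) hyz, h0]
  set R : ℕ × (Fin n → ℤ) → Set (EuclideanSpace ℝ (Fin n)) :=
    fun q => firstBad q.1 ∩ gridCell x ℓ q.1 q.2 with hR
  -- Being selected depends only on the cell, so each `R q` is empty or a whole cell; the empty ones
  -- are dropped from the index type.
  have hR_eq : ∀ q, (R q).Nonempty → R q = gridCell x ℓ q.1 q.2 := fun q ⟨y, hy⟩ =>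
    inter_eq_right.2 fun z hz => hfirst_congr (hy.2.trans hz.symm) hy.1
  have hv : ∀ k m, volume (gridCell x ℓ k m) = ENNReal.ofReal (ℓ / 2 ^ k) ^ n := fun k m => by
    rw [measure_congr (gridCell_ae_eq_cube x hℓ k m), volume_cube _ (by positivity)]
  refine ⟨{q // (R q).Nonempty}, inferInstance, fun q => gridCenter x ℓ q.1.1 q.1.2,
    fun q => ℓ / 2 ^ q.1.1, fun q => R q.1, fun q => by positivity,
    fun q => (hfirst_meas _).inter (hcell_meas _ _), ?_,
    fun q => inter_subset_left.trans (fun y hy => hzero hy.1),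
    fun q => inter_subset_right.trans (gridCell_subset_cube x hℓ _ _), fun q => ?_, fun q => ?_,
    fun q => ?_, ?_⟩
  · rintro ⟨⟨k, m⟩, hq⟩ ⟨⟨k', m'⟩, hq'⟩ hne
    refine Set.disjoint_left.2 fun y hy hy' => hne ?_
    have hkk : k = k' := by
      rcases lt_trichotomy k k' with hlt | heq | hlt
      · exact absurd hy.1.2.1 (hy'.1.2.2 k hlt)
      · exact heq
      · exact absurd hy'.1.2.1 (hy.1.2.2 k' hlt)
    subst hkk
    have : m = m' := hy.2.symm.trans hy'.2
    subst this
    rfl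
  · dsimp only
    rw [hR_eq _ q.2]
    exact gridCell_ae_eq_cube x hℓ _ _
  · obtain ⟨y, hy⟩ := q.2
    rw [← mean_congr_set (gridCell_ae_eq_cube x hℓ _ _)]
    have hb := hy.1.2.1
    simp only [hbad] at hb
    rwa [show gridIndex x ℓ q.1.1 y = q.1.2 from hy.2] at hb
  · obtain ⟨⟨k, m⟩, ⟨y, hy⟩⟩ := q
    dsimp only
    rw [← mean_congr_set (gridCell_ae_eq_cube x hℓ _ _)]
    cases k with
    | zero =>
      exfalso
      have hb := hy.1.2.1
      have h0 : gridIndex x ℓ 0 y = 0 := hy.1.1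
      simp only [hbad, h0, mean_congr_set hzero_ae] at hb
      exact absurd hs (not_le.2 hb)
    | succ k =>
      -- The parent was not selected, and it has `2 ^ n` times the volume of the child.
      have hnb := not_lt.1 (hy.1.2.2 k (Nat.lt_succ_self k))
      refine (mean_le_mul_mean (Q' := gridCell x ℓ k (gridIndex x ℓ k y)) (C := 2 ^ n)
        (fun z hz => ?_) (by positivity) (by finiteness) ?_ g).trans (by gcongr)
      · exact gridIndex_eq_of_le x ℓ k.le_succ (hz.trans hy.2.symm)
      · rw [hv, hv, ← mul_pow]
        congr 1
        rw [← ENNReal.ofReal_ofNat, ← ENNReal.ofReal_mul (by norm_num)]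
        congr 1
        rw [pow_succ]; field_simp
  · have h1 : ∀ᵐ y, (y ∈ gridCell x ℓ 0 0) = (y ∈ cube x ℓ) := hzero_ae
    filter_upwards [h1, ae_enorm_le_of_mean_cube_le hh s] with y hy hle hyQ hyR
    rw [← hy] at hyQ
    -- A point in no selected cell has only good cells, which shrink to it, so differentiation
    -- applies.
    have hnb : ∀ k, ¬ bad k y := by
      by_contra! hex
      refine hyR (mem_iUnion.2 ⟨⟨(Nat.find hex, gridIndex x ℓ (Nat.find hex) y), ⟨y, ?_⟩⟩, ?_⟩) <;>
      exact ⟨⟨hyQ, Nat.find_spec hex, fun j hj => Nat.find_min hex hj⟩, rfl⟩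
    refine hle (fun k => gridCenter x ℓ k (gridIndex x ℓ k y)) (fun k => ℓ / 2 ^ k) ?_
      (fun k => by positivity) (fun k => gridCell_subset_cube x hℓ _ _ rfl) fun k => ?_
    · rw [tendsto_nhdsWithin_iff]
      refine ⟨?_, Filter.Eventually.of_forall fun k => show (0 : ℝ) < ℓ / 2 ^ k by positivity⟩
      exact (tendsto_pow_atTop_atTop_of_one_lt (by norm_num : (1 : ℝ) < 2)).const_div_atTop ℓ
    · rw [← mean_congr_set (gridCell_ae_eq_cube x hℓ _ _)]
      exact not_lt.1 (hnb k)

end DyadicGrid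

/-! ### The John–Nirenberg inequality for measures with a halving bound. -/

section JohnNirenberg

variable {n : ℕ} {𝕜 : Type*} [RCLike 𝕜]

/-- Subsets of a cube of at most half of its volume carry at most the fraction `η` of its
`μ`-measure. -/
def HalvingBound (μ : Measure (EuclideanSpace ℝ (Fin n))) (η : ℝ≥0∞) : Prop :=
  ∀ (x : EuclideanSpace ℝ (Fin n)) (ℓ : ℝ), 0 < ℓ → ∀ E ⊆ cube x ℓ, MeasurableSet E →
    2 * volume E ≤ volume (cube x ℓ) → μ E ≤ η * μ (cube x ℓ)

theorem integrableOn_cube {b : EuclideanSpace ℝ (Fin n) → 𝕜} (hb : LocallyIntegrable b volume)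
    (x : EuclideanSpace ℝ (Fin n)) (ℓ : ℝ) : IntegrableOn b (cube x ℓ) volume :=
  hb.integrableOn_isCompact (isCompact_cube x ℓ)

theorem enorm_setAverage_sub_le_mean {b : EuclideanSpace ℝ (Fin n) → 𝕜}
    (hb : LocallyIntegrable b volume) (x : EuclideanSpace ℝ (Fin n)) {ℓ : ℝ} (hℓ : 0 < ℓ) (a : 𝕜) :
    ‖(⨍ z in cube x ℓ, b z) - a‖ₑ ≤ mean (cube x ℓ) (fun z => ‖b z - a‖ₑ) := by
  have h0 := volume_cube_ne_zero x hℓ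
  have h1 := volume_cube_ne_top x hℓ.le
  have e : (⨍ z in cube x ℓ, b z) - a = ⨍ z in cube x ℓ, (b z - a) := by
    have hr : volume.real (cube x ℓ) ≠ 0 := ENNReal.toReal_ne_zero.2 ⟨h0, h1⟩
    rw [setAverage_eq, setAverage_eq, integral_sub (integrableOn_cube hb x ℓ)
      (integrableOn_const h1), smul_sub, setIntegral_const, smul_smul, inv_mul_cancel₀ hr, one_smul]
  rw [e]
  exact enorm_setAverage_le_mean _ _ h0 h1

theorem mean_le_bmoSeminorm (b : EuclideanSpace ℝ (Fin n) → 𝕜) (x : EuclideanSpace ℝ (Fin n))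
    {ℓ : ℝ} (hℓ : 0 < ℓ) :
    mean (cube x ℓ) (fun y => ‖b y - ⨍ z in cube x ℓ, b z‖ₑ) ≤ bmoSeminorm b :=
  le_iSup_of_le x (le_iSup_of_le ℓ (le_iSup_of_le hℓ le_rfl))

/-- The John–Nirenberg inequality for a measure satisfying a halving bound. -/
theorem HalvingBound.measure_oscillation_le {μ : Measure (EuclideanSpace ℝ (Fin n))} {η : ℝ≥0∞}
    (hη : HalvingBound μ η) (hμ : μ ≪ volume) {b : EuclideanSpace ℝ (Fin n) → 𝕜}
    (hb : LocallyIntegrable b volume) {s A : ℝ≥0∞} (hs0 : s ≠ 0) (hs : 2 * bmoSeminorm b ≤ s)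
    (hsA : s < A) (hA : 2 ^ n * s ≤ A) (hA_top : A ≠ ∞) (k : ℕ)
    (x : EuclideanSpace ℝ (Fin n)) {ℓ : ℝ} (hℓ : 0 < ℓ) :
    μ {y | y ∈ cube x ℓ ∧ k * A ≤ ‖b y - ⨍ z in cube x ℓ, b z‖ₑ} ≤ η ^ k * μ (cube x ℓ) := by
  induction k generalizing x ℓ with
  | zero => simp
  | succ k ih =>
    set a := ⨍ z in cube x ℓ, b z with ha
    have hst : s ≠ ∞ := (hsA.trans_le le_top).ne
    have hmean := mean_le_bmoSeminorm b x hℓ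
    have hm : mean (cube x ℓ) (fun z => ‖b z - a‖ₑ) ≤ s :=
      hmean.trans (le_trans (by rw [two_mul]; exact le_self_add) hs)
    obtain ⟨ι, _, c, r, R, hr, hRm, hRd, hRQ, hRc, hRae, hlow, hup, hgood⟩ :=
      exists_calderonZygmund_decomposition (hb.sub (locallyIntegrable_const a)) x hℓ hm
    simp only [Pi.sub_apply] at hlow hup hgood
    -- Chebyshev on the selected cubes: `s |⋃ R i| ≤ ∫_Q |b - a| ≤ ‖b‖_* |Q|`, and `2 ‖b‖_* ≤ s`.
    have hvol : 2 * volume (⋃ i, R i) ≤ volume (cube x ℓ) := by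
      have h1 : s * volume (⋃ i, R i) ≤ bmoSeminorm b * volume (cube x ℓ) := by
        calc s * volume (⋃ i, R i) = ∑' i, s * volume (R i) := by
              rw [measure_iUnion hRd hRm, ENNReal.tsum_mul_left]
          _ ≤ ∑' i, ∫⁻ z in R i, ‖b z - a‖ₑ := by
              refine ENNReal.tsum_le_tsum fun i => ?_
              rw [setLIntegral_congr (hRae i), measure_congr (hRae i)]
              have := (hlow i).le
              rw [mean, mul_comm, ← div_eq_mul_inv] at this
              exact ENNReal.mul_le_of_le_div this
          _ = ∫⁻ z in ⋃ i, R i, ‖b z - a‖ₑ := (lintegral_iUnion hRm hRd _).symm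
          _ ≤ ∫⁻ z in cube x ℓ, ‖b z - a‖ₑ := lintegral_mono_set (iUnion_subset hRQ)
          _ = mean (cube x ℓ) (fun z => ‖b z - a‖ₑ) * volume (cube x ℓ) := by
              rw [mean, mul_comm, ← mul_assoc, ENNReal.mul_inv_cancel (volume_cube_ne_zero x hℓ)
                (volume_cube_ne_top x hℓ.le), one_mul]
          _ ≤ _ := by gcongr
      refine (ENNReal.mul_le_mul_iff_right hs0 hst).1 ?_
      calc s * (2 * volume (⋃ i, R i)) = 2 * (s * volume (⋃ i, R i)) := by ring
        _ ≤ 2 * (bmoSeminorm b * volume (cube x ℓ)) := by gcongr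
        _ = (2 * bmoSeminorm b) * volume (cube x ℓ) := by ring
        _ ≤ s * volume (cube x ℓ) := by gcongr
    -- Off the selected cubes `|b - a| ≤ s < A`. On a selected cube its own average differs from `a`
    -- by at most `2 ^ n * s ≤ A`, so passing to it lowers the level by one `A`.
    have hcover : {y | y ∈ cube x ℓ ∧ ((k + 1 : ℕ) : ℝ≥0∞) * A ≤ ‖b y - a‖ₑ} ≤ᵐ[μ]
        ⋃ i, {y | y ∈ cube (c i) (r i) ∧ k * A ≤ ‖b y - ⨍ z in cube (c i) (r i), b z‖ₑ} := by
      filter_upwards [hμ.ae_le hgood] with y hy ⟨hyQ, hyA⟩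
      have hyR : y ∈ ⋃ i, R i := by
        by_contra hyR
        have h1 := hy hyQ hyR
        refine absurd (hsA.trans_le (le_trans ?_ hyA)) (not_lt.2 h1)
        rw [Nat.cast_succ, add_mul, one_mul]
        exact le_add_self
      obtain ⟨i, hi⟩ := mem_iUnion.1 hyR
      refine mem_iUnion.2 ⟨i, hRc i hi, ?_⟩
      have h2 := (enorm_setAverage_sub_le_mean hb (c i) (hr i) a).trans ((hup i).trans hA)
      have h3 : ‖b y - a‖ₑ ≤ ‖b y - ⨍ z in cube (c i) (r i), b z‖ₑ + A := by
        refine le_trans ?_ (add_le_add_right h2 _)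
        refine le_trans (le_of_eq ?_) (enorm_add_le _ _)
        congr 1; ring
      rw [Nat.cast_succ, add_mul, one_mul] at hyA
      exact (ENNReal.add_le_add_iff_right hA_top).1 (hyA.trans h3)
    calc _ ≤ _ := measure_mono_ae hcover
      _ ≤ _ := measure_iUnion_le _
      _ ≤ ∑' i, η ^ k * μ (cube (c i) (r i)) := ENNReal.tsum_le_tsum fun i => ih (c i) (hr i)
      _ = ∑' i, η ^ k * μ (R i) := by
          congr 1; ext i; rw [measure_congr (hμ.ae_eq (hRae i))]
      _ = η ^ k * μ (⋃ i, R i) := by rw [measure_iUnion hRd hRm, ENNReal.tsum_mul_left]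
      _ ≤ η ^ k * (η * μ (cube x ℓ)) := by
          gcongr
          exact hη x ℓ hℓ _ (iUnion_subset hRQ) (MeasurableSet.iUnion hRm) hvol
      _ = _ := by ring

/-- Exponential integrability of the oscillation of a function in `BMO`. -/
theorem HalvingBound.exists_lintegral_exp_le {μ : Measure (EuclideanSpace ℝ (Fin n))} {η : ℝ≥0∞}
    (hη : HalvingBound μ η) (hη1 : η < 1) (hμ : μ ≪ volume) {b : EuclideanSpace ℝ (Fin n) → 𝕜}
    (hb : MemBMO b) :
    ∃ c : ℝ, 0 < c ∧ ∃ K : ℝ≥0∞, K ≠ ∞ ∧ ∀ (x : EuclideanSpace ℝ (Fin n)) (ℓ : ℝ), 0 < ℓ →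
      ∫⁻ y in cube x ℓ, ENNReal.ofReal (Real.exp (c * ‖b y - ⨍ z in cube x ℓ, b z‖)) ∂μ
        ≤ K * μ (cube x ℓ) := by
  obtain ⟨hbl, hbS⟩ := hb
  -- The added 1 keeps the height positive when the seminorm of `b` vanishes.
  set s : ℝ≥0∞ := 2 * bmoSeminorm b + 1
  have hs0 : s ≠ 0 := by positivity
  have hst : s ≠ ∞ := by simp only [s]; finiteness
  set A : ℝ≥0∞ := 2 ^ n * s + s + 1
  have hAt : A ≠ ∞ := by simp only [A]; finiteness
  have hsA : s < A := by
    calc s < s + 1 := ENNReal.lt_add_right hst one_ne_zero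
      _ ≤ A := by simp only [A, add_assoc]; exact le_add_self
  have hA2 : 2 ^ n * s ≤ A := by simp only [A, add_assoc]; exact le_self_add
  set α := A.toReal
  have hα : 0 < α := ENNReal.toReal_pos (zero_le.trans_lt hsA).ne' hAt
  -- With `exp (c α) = 1 / q`, the strict inequality `η < q` gives geometric decay and also keeps
  -- `q` positive when `η = 0`.
  obtain ⟨q, hηq, hq1⟩ := exists_between hη1
  have hq0 : 0 < q := zero_le.trans_lt hηq
  have hqt : q ≠ ∞ := (hq1.trans_le le_top).ne
  -- the growth rate `M = exp (c α)` is chosen with `M * η < 1`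
  obtain ⟨c, hc, hcη⟩ : ∃ c : ℝ, 0 < c ∧ ENNReal.ofReal (Real.exp (c * α)) * η < 1 := by
    have hlog : 0 < -Real.log q.toReal := by
      have := Real.log_neg (ENNReal.toReal_pos hq0.ne' hqt)
        (by simpa using (ENNReal.toReal_lt_toReal hqt ENNReal.one_ne_top).2 hq1)
      linarith
    refine ⟨-Real.log q.toReal / α, by positivity, ?_⟩
    rw [div_mul_cancel₀ _ hα.ne', Real.exp_neg, Real.exp_log (ENNReal.toReal_pos hq0.ne' hqt),
      ENNReal.ofReal_inv_of_pos (ENNReal.toReal_pos hq0.ne' hqt), ENNReal.ofReal_toReal hqt]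
    calc q⁻¹ * η < q⁻¹ * q := by
          rw [ENNReal.mul_lt_mul_iff_right (ENNReal.inv_ne_zero.2 hqt)
            (ENNReal.inv_ne_top.2 hq0.ne')]
          exact hηq
      _ = 1 := ENNReal.inv_mul_cancel hq0.ne' hqt
  set M := ENNReal.ofReal (Real.exp (c * α)) with hM
  refine ⟨c, hc, ∑' k : ℕ, M ^ (k + 1) * η ^ k, ?_, fun x ℓ hℓ => ?_⟩
  · have : ∀ k : ℕ, M ^ (k + 1) * η ^ k = M * (M * η) ^ k := fun k => by ring
    simp only [this, ENNReal.tsum_mul_left, ENNReal.tsum_geometric]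
    refine ENNReal.mul_ne_top ENNReal.ofReal_ne_top (ENNReal.inv_ne_top.2 ?_)
    exact (tsub_pos_of_lt hcη).ne'
  · set a := ⨍ z in cube x ℓ, b z
    set S : ℕ → Set (EuclideanSpace ℝ (Fin n)) := fun k => {y | k * A ≤ ‖b y - a‖ₑ}
    have hbm : AEMeasurable (fun y => ‖b y - a‖ₑ) (μ.restrict (cube x ℓ)) :=
      ((hbl.aestronglyMeasurable.sub aestronglyMeasurable_const).enorm.mono_ac hμ).restrict
    have hSm : ∀ k, NullMeasurableSet (S k) (μ.restrict (cube x ℓ)) := fun k =>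
      nullMeasurableSet_le aemeasurable_const hbm
    -- Layer decomposition: for `k = ⌊t / α⌋₊`, the single term `M ^ (k + 1)` already dominates `exp
    -- (c t)`.
    calc _ ≤ ∫⁻ y in cube x ℓ, ∑' k : ℕ, (S k).indicator (fun _ => M ^ (k + 1)) y ∂μ := by
          refine lintegral_mono fun y => ?_
          set t := ‖b y - a‖
          set k := ⌊t / α⌋₊
          have hk : y ∈ S k := by
            have h1 : (k : ℝ) * α ≤ t := by
              have := Nat.floor_le (show 0 ≤ t / α by positivity)
              rwa [le_div_iff₀ hα] at this
            have h2 := ENNReal.ofReal_le_ofReal h1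
            rw [ENNReal.ofReal_mul (by positivity), ENNReal.ofReal_natCast,
              ENNReal.ofReal_toReal hAt, ofReal_norm] at h2
            exact h2
          refine le_trans ?_ (ENNReal.le_tsum k)
          rw [indicator_of_mem hk, hM, ← ENNReal.ofReal_pow (by positivity), ← Real.exp_nat_mul]
          refine ENNReal.ofReal_le_ofReal (Real.exp_le_exp.2 ?_)
          have h3 : t < (k + 1 : ℝ) * α := by
            have := Nat.lt_floor_add_one (t / α)
            rwa [div_lt_iff₀ hα] at this
          push_cast
          nlinarith
      _ = ∑' k : ℕ, ∫⁻ y in cube x ℓ, (S k).indicator (fun _ => M ^ (k + 1)) y ∂μ :=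
          lintegral_tsum fun k => aemeasurable_const.indicator₀ (hSm k)
      _ ≤ ∑' k : ℕ, M ^ (k + 1) * (η ^ k * μ (cube x ℓ)) := by
          refine ENNReal.tsum_le_tsum fun k => (lintegral_indicator_const_le _ _).trans ?_
          gcongr
          rw [Measure.restrict_apply' (measurableSet_cube x ℓ), inter_comm]
          exact hη.measure_oscillation_le hμ hbl hs0 le_self_add hsA hA2 hAt k x hℓ
      _ = _ := by simp only [← mul_assoc, ENNReal.tsum_mul_right]

theorem halvingBound_volume :
    HalvingBound (volume : Measure (EuclideanSpace ℝ (Fin n))) 2⁻¹ := by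
  intro x ℓ _ E _ _ h
  rw [← ENNReal.div_eq_inv_mul, ENNReal.le_div_iff_mul_le (by simp) (by simp), mul_comm]
  exact h

end JohnNirenberg

/-! ### Consequences of the Muckenhoupt condition: positivity, halving, doubling. -/

section Muckenhoupt

variable {n : ℕ} {w : EuclideanSpace ℝ (Fin n) → ℝ}

theorem IsWeight.aemeasurable (hw : IsWeight w) :
    AEMeasurable (fun x => ENNReal.ofReal (w x)) volume :=
  hw.locallyIntegrable.aestronglyMeasurable.aemeasurable.ennreal_ofReal

theorem wMeasure_absolutelyContinuous : wMeasure w ≪ volume :=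
  withDensity_absolutelyContinuous _ _

theorem wMeasure_cube (x : EuclideanSpace ℝ (Fin n)) (ℓ : ℝ) :
    wMeasure w (cube x ℓ) = ∫⁻ y in cube x ℓ, ENNReal.ofReal (w y) :=
  withDensity_apply _ (measurableSet_cube x ℓ)

theorem wMeasure_cube_ne_top (hw : IsWeight w) (x : EuclideanSpace ℝ (Fin n)) (ℓ : ℝ) :
    wMeasure w (cube x ℓ) ≠ ∞ := by
  rw [wMeasure_cube]
  refine (lt_of_le_of_lt (lintegral_mono fun y => ?_)
    (integrableOn_cube hw.locallyIntegrable x ℓ).2).ne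
  exact Real.ofReal_le_enorm _

theorem wMeasure_cube_ne_zero (hw : IsWeight w) (hpos : ∀ᵐ x, 0 < w x)
    (x : EuclideanSpace ℝ (Fin n)) {ℓ : ℝ} (hℓ : 0 < ℓ) : wMeasure w (cube x ℓ) ≠ 0 := by
  rw [wMeasure_cube]
  intro h
  rw [lintegral_eq_zero_iff' hw.aemeasurable.restrict] at h
  have h2 : ∀ᵐ y ∂(volume.restrict (cube x ℓ)), False := by
    filter_upwards [h, ae_restrict_of_ae hpos] with y hy hy'
    simp only [Pi.zero_apply, ENNReal.ofReal_eq_zero] at hy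
    linarith
  rw [ae_iff] at h2
  simp only [not_false_eq_true, ofPred_true, Measure.restrict_apply_univ] at h2
  exact volume_cube_ne_zero x hℓ h2

theorem iUnion_cube_natCast (x : EuclideanSpace ℝ (Fin n)) :
    ⋃ N : ℕ, cube x ((N : ℝ) + 1) = univ := by
  refine eq_univ_of_forall fun y => mem_iUnion.2 ?_
  obtain ⟨N, hN⟩ := exists_nat_ge (2 * ‖y - x‖)
  refine ⟨N, fun i => ?_⟩
  have := PiLp.norm_apply_le (y - x) i
  rw [PiLp.sub_apply, Real.norm_eq_abs] at this
  linarith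

/-- If `w` vanishes on a non-null part of a cube, the dual mean is infinite on every larger
concentric cube, and a finite product then forces the mean of `w` to be zero there. Because `0 * ∞ =
0` the zero weight belongs to `A_q`, so this alternative cannot be excluded. -/
theorem MemAp.ae_eq_zero_or_ae_pos {q : ℝ} (hq : 1 < q) (hw : MemAp q w) :
    (∀ᵐ x, w x = 0) ∨ ∀ᵐ x, 0 < w x := by
  obtain ⟨hw, C, hC⟩ := hw
  have hq' : q.HolderConjugate q.conjExponent := Real.HolderConjugate.conjExponent hq
  refine or_iff_not_imp_right.2 fun hpos => ?_
  rw [ae_iff, ← inter_univ {a | ¬0 < w a}, ← iUnion_cube_natCast 0, inter_iUnion] at hpos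
  have hex : ∃ N : ℕ, volume ({a | ¬0 < w a} ∩ cube 0 ((N : ℝ) + 1)) ≠ 0 := by
    by_contra h
    push Not at h
    simp only [← not_lt] at h
    exact hpos (measure_iUnion_null h)
  obtain ⟨N, hN⟩ := hex
  have hzero : ∀ k : ℕ, ∀ᵐ x ∂volume.restrict (cube 0 (((N + k : ℕ) : ℝ) + 1)), w x = 0 := by
    intro k
    set Q : Set (EuclideanSpace ℝ (Fin n)) := cube 0 (((N + k : ℕ) : ℝ) + 1)
    have hQpos : (0 : ℝ) < ((N + k : ℕ) : ℝ) + 1 := by positivity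
    have hexp : -(q.conjExponent / q) < 0 := neg_neg_of_pos (div_pos hq'.symm.pos hq'.pos)
    have hinf : ∫⁻ y in Q, ENNReal.ofReal (w y) ^ (-(q.conjExponent / q)) = ∞ := by
      by_contra hfin
      have hlt := ae_lt_top' (hw.aemeasurable.pow_const _).restrict hfin
      refine hN (measure_mono_null (inter_subset_inter_right _
        (cube_subset_cube 0 (ℓ' := ((N + k : ℕ) : ℝ) + 1) (by push_cast; linarith))) ?_)
      rw [ae_restrict_iff' (measurableSet_cube _ _), ae_iff] at hlt
      refine measure_mono_null (fun y hy => ?_) hlt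
      simp only [mem_ofPred_eq, Classical.not_imp]
      refine ⟨hy.2, ?_⟩
      rw [ENNReal.ofReal_of_nonpos (not_lt.1 hy.1), ENNReal.zero_rpow_of_neg hexp]
      simp
    have h := hC 0 _ hQpos
    have h1 : mean Q (fun y => ENNReal.ofReal (w y) ^ (-(q.conjExponent / q))) = ∞ := by
      rw [mean, hinf, ENNReal.mul_top (ENNReal.inv_ne_zero.2 (volume_cube_ne_top _ hQpos.le))]
    rw [h1, ENNReal.top_rpow_of_pos (one_div_pos.2 hq'.symm.pos)] at h
    have h2 : mean Q (fun y => ENNReal.ofReal (w y)) ^ (1 / q) = 0 := by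
      by_contra hne
      rw [ENNReal.mul_top hne] at h
      exact ENNReal.coe_ne_top (top_le_iff.1 h)
    rw [ENNReal.rpow_eq_zero_iff_of_pos (one_div_pos.2 hq'.pos), mean, mul_eq_zero] at h2
    rcases h2 with h2 | h2
    · exact absurd h2 (ENNReal.inv_ne_zero.2 (volume_cube_ne_top _ hQpos.le))
    · rw [lintegral_eq_zero_iff' hw.aemeasurable.restrict] at h2
      filter_upwards [h2] with y hy
      exact le_antisymm (ENNReal.ofReal_eq_zero.1 hy) (hw.nonneg y)
  have hall := ae_restrict_iUnion_iff _ (fun x => w x = 0) |>.2 hzero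
  have huniv : ⋃ k : ℕ, cube (0 : EuclideanSpace ℝ (Fin n)) (((N + k : ℕ) : ℝ) + 1) = univ := by
    refine eq_univ_of_univ_subset ?_
    rw [← iUnion_cube_natCast 0]
    exact iUnion_mono fun k => cube_subset_cube 0 (by push_cast; linarith)
  rwa [huniv, Measure.restrict_univ] at hall

/-- Hölder's inequality on `F` with `1 = w^(1/q) w^(-1/q)`, followed by the `A_q` bound on the whole
cube. Both halving and doubling are special choices of `F`. -/
theorem MemAp.exists_rpow_mul_wMeasure_le {q : ℝ} (hq : 1 < q) (hw : MemAp q w)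
    (hpos : ∀ᵐ x, 0 < w x) :
    ∃ C : ℝ≥0∞, C ≠ 0 ∧ C ≠ ∞ ∧ ∀ (x : EuclideanSpace ℝ (Fin n)) (ℓ : ℝ), 0 < ℓ →
      ∀ F ⊆ cube x ℓ, MeasurableSet F →
        (volume F / volume (cube x ℓ)) ^ q * wMeasure w (cube x ℓ) ≤ C * wMeasure w F := by
  obtain ⟨hw, C, hC⟩ := hw
  have hq' : q.HolderConjugate q.conjExponent := Real.HolderConjugate.conjExponent hq
  refine ⟨((C : ℝ≥0∞) + 1) ^ q, ?_, ?_, fun x ℓ hℓ F hF hFm => ?_⟩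
  -- Adding 1 to the `A_q` constant makes it nonzero.
  · rw [Ne, ENNReal.rpow_eq_zero_iff_of_pos hq'.pos]; positivity
  · exact ENNReal.rpow_ne_top_of_nonneg hq'.pos.le (by finiteness)
  have hC := hC x ℓ hℓ
  set V := volume (cube x ℓ)
  have hV0 : V ≠ 0 := volume_cube_ne_zero x hℓ
  have hVt : V ≠ ∞ := volume_cube_ne_top x hℓ.le
  have hWF : wMeasure w F = ∫⁻ y in F, ENNReal.ofReal (w y) := withDensity_apply _ hFm
  have hWQ := wMeasure_cube (w := w) x ℓ
  set I := ∫⁻ y in cube x ℓ, ENNReal.ofReal (w y) ^ (-(q.conjExponent / q)) with hI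
  rw [mean, mean, ← hWQ, ← hI, ENNReal.mul_rpow_of_nonneg _ _ (one_div_pos.2 hq'.pos).le,
    ENNReal.mul_rpow_of_nonneg _ _ (one_div_pos.2 hq'.symm.pos).le] at hC
  have hVV : V⁻¹ ^ (1 / q) * V⁻¹ ^ (1 / q.conjExponent) = V⁻¹ := by
    rw [← ENNReal.rpow_add _ _ (ENNReal.inv_ne_zero.2 hVt) (ENNReal.inv_ne_top.2 hV0), one_div,
      one_div, hq'.inv_add_inv_eq_one, ENNReal.rpow_one]
  have hholder : volume F ≤ wMeasure w F ^ (1 / q) * I ^ (1 / q.conjExponent) := by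
    calc volume F
        = ∫⁻ y in F, ENNReal.ofReal (w y) ^ (1 / q) * ENNReal.ofReal (w y) ^ (-(1 / q)) := by
          rw [← setLIntegral_one]
          refine lintegral_congr_ae ?_
          filter_upwards [ae_restrict_of_ae hpos] with y hy
          rw [← ENNReal.rpow_add _ _ (by simpa using hy) ENNReal.ofReal_ne_top, add_neg_cancel,
            ENNReal.rpow_zero]
      _ ≤ (∫⁻ y in F, (ENNReal.ofReal (w y) ^ (1 / q)) ^ q) ^ (1 / q) *
          (∫⁻ y in F, (ENNReal.ofReal (w y) ^ (-(1 / q))) ^ q.conjExponent)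
            ^ (1 / q.conjExponent) :=
          ENNReal.lintegral_mul_le_Lp_mul_Lq _ hq' (hw.aemeasurable.pow_const _).restrict
            (hw.aemeasurable.pow_const _).restrict
      _ ≤ _ := by
          have e1 : ∀ y, (ENNReal.ofReal (w y) ^ (1 / q)) ^ q = ENNReal.ofReal (w y) := fun y => by
            rw [← ENNReal.rpow_mul, one_div_mul_cancel hq'.ne_zero, ENNReal.rpow_one]
          have e2 : ∀ y, (ENNReal.ofReal (w y) ^ (-(1 / q))) ^ q.conjExponent
              = ENNReal.ofReal (w y) ^ (-(q.conjExponent / q)) := fun y => by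
            rw [← ENNReal.rpow_mul]; congr 1; ring
          simp only [e1, e2]
          rw [hWF]
          have := hq'.symm.pos
          gcongr
          exact lintegral_mono_set hF
  have hmain : volume F / V * wMeasure w (cube x ℓ) ^ (1 / q)
      ≤ C * wMeasure w F ^ (1 / q) := by
    calc volume F / V * wMeasure w (cube x ℓ) ^ (1 / q)
        ≤ (wMeasure w F ^ (1 / q) * I ^ (1 / q.conjExponent)) / V
          * wMeasure w (cube x ℓ) ^ (1 / q) := by gcongr
      _ = (V⁻¹ ^ (1 / q) * wMeasure w (cube x ℓ) ^ (1 / q)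
          * (V⁻¹ ^ (1 / q.conjExponent) * I ^ (1 / q.conjExponent))) * wMeasure w F ^ (1 / q) := by
          rw [div_eq_mul_inv]; nth_rw 1 [← hVV]; ring
      _ ≤ _ := by gcongr
  have hroot : ∀ t : ℝ≥0∞, (t ^ (1 / q)) ^ q = t := fun t => by
    rw [← ENNReal.rpow_mul, one_div_mul_cancel hq'.ne_zero, ENNReal.rpow_one]
  have := ENNReal.rpow_le_rpow hmain hq'.pos.le
  rw [ENNReal.mul_rpow_of_nonneg _ _ hq'.pos.le, ENNReal.mul_rpow_of_nonneg _ _ hq'.pos.le,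
    hroot, hroot] at this
  refine this.trans ?_
  have := hq'.pos
  gcongr
  exact le_self_add

/-- The complement of `E` fills at least half of the cube, hence carries at least the fraction `d =
2^(-q) / C` of the `w`-mass; `η = 1 - d`. -/
theorem MemAp.exists_halvingBound {q : ℝ} (hq : 1 < q) (hw : MemAp q w) (hpos : ∀ᵐ x, 0 < w x) :
    ∃ η : ℝ≥0∞, η < 1 ∧ HalvingBound (wMeasure w) η := by
  obtain ⟨C, hC0, hCt, hC⟩ := hw.exists_rpow_mul_wMeasure_le hq hpos
  set d : ℝ≥0∞ := 2⁻¹ ^ q / C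
  have hd : d ≠ 0 := (ENNReal.div_pos (ENNReal.rpow_pos (by simp) (by simp)).ne' hCt).ne'
  refine ⟨1 - d, ENNReal.sub_lt_self ENNReal.one_ne_top one_ne_zero hd,
    fun x ℓ hℓ E hE hEm h => ?_⟩
  have hWt := wMeasure_cube_ne_top hw.1 x ℓ
  have hV0 := volume_cube_ne_zero x hℓ
  have hVt := volume_cube_ne_top x hℓ.le
  have hEt : volume E ≠ ∞ := ((measure_mono hE).trans_lt (lt_top_iff_ne_top.2 hVt)).ne
  have hF := hC x ℓ hℓ (cube x ℓ \ E) sdiff_subset ((measurableSet_cube x ℓ).diff hEm)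
  have hhalf : 2⁻¹ ≤ volume (cube x ℓ \ E) / volume (cube x ℓ) := by
    rw [ENNReal.le_div_iff_mul_le (Or.inl hV0) (Or.inl hVt),
      measure_sdiff hE hEm.nullMeasurableSet hEt]
    refine ENNReal.le_sub_of_add_le_right hEt ?_
    calc 2⁻¹ * volume (cube x ℓ) + volume E
        = 2⁻¹ * (volume (cube x ℓ) + 2 * volume E) := by
          rw [mul_add, ← mul_assoc, ENNReal.inv_mul_cancel (by simp) (by simp), one_mul]
      _ ≤ 2⁻¹ * (volume (cube x ℓ) + volume (cube x ℓ)) := by gcongr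
      _ = _ := by
          rw [← two_mul, ← mul_assoc, ENNReal.inv_mul_cancel (by simp) (by simp), one_mul]
  have hdF : d * wMeasure w (cube x ℓ) ≤ wMeasure w (cube x ℓ \ E) := by
    rw [show d * wMeasure w (cube x ℓ) = 2⁻¹ ^ q * wMeasure w (cube x ℓ) / C by
      simp only [d, div_eq_mul_inv]; ring]
    refine ENNReal.div_le_of_le_mul' (le_trans ?_ hF)
    gcongr
  rw [ENNReal.sub_mul (fun _ _ => hWt), one_mul]
  refine ENNReal.le_sub_of_add_le_right ?_ ?_
  · exact (hdF.trans_lt ((measure_mono sdiff_subset).trans_lt (lt_top_iff_ne_top.2 hWt))).ne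
  · calc wMeasure w E + d * wMeasure w (cube x ℓ)
        ≤ wMeasure w (cube x ℓ ∩ E) + wMeasure w (cube x ℓ \ E) := by
          rw [inter_eq_right.2 hE]; gcongr
      _ = wMeasure w (cube x ℓ) := measure_inter_add_sdiff _ hEm

theorem MemAp.exists_wMeasure_cube_two_mul_le {q : ℝ} (hq : 1 < q) (hw : MemAp q w)
    (hpos : ∀ᵐ x, 0 < w x) : ∃ C : ℝ≥0∞, C ≠ ∞ ∧ ∀ (x : EuclideanSpace ℝ (Fin n)) (ℓ : ℝ), 0 < ℓ →
      wMeasure w (cube x (2 * ℓ)) ≤ C * wMeasure w (cube x ℓ) := by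
  obtain ⟨C, hC0, hCt, hC⟩ := hw.exists_rpow_mul_wMeasure_le hq hpos
  have h2 : (2 ^ n : ℝ≥0∞)⁻¹ ^ q ≠ 0 :=
    (ENNReal.rpow_pos (ENNReal.inv_pos.2 (by finiteness)) (by simp)).ne'
  have h2t : (2 ^ n : ℝ≥0∞)⁻¹ ^ q ≠ ∞ := ENNReal.rpow_ne_top_of_nonneg (by linarith) (by simp)
  refine ⟨C / (2 ^ n : ℝ≥0∞)⁻¹ ^ q, ENNReal.div_ne_top hCt h2, fun x ℓ hℓ => ?_⟩
  have h := hC x (2 * ℓ) (by positivity) (cube x ℓ) (cube_subset_cube x (by linarith))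
    (measurableSet_cube x ℓ)
  have e : volume (cube x ℓ) / volume (cube x (2 * ℓ)) = (2 ^ n)⁻¹ := by
    rw [volume_cube_two_mul x hℓ.le, div_eq_mul_inv, ENNReal.mul_inv (by simp) (by simp), mul_comm,
      mul_assoc, ENNReal.inv_mul_cancel (volume_cube_ne_zero x hℓ) (volume_cube_ne_top x hℓ.le),
      mul_one]
  rw [e] at h
  rw [show C / (2 ^ n : ℝ≥0∞)⁻¹ ^ q * wMeasure w (cube x ℓ)
    = C * wMeasure w (cube x ℓ) / (2 ^ n : ℝ≥0∞)⁻¹ ^ q by simp only [div_eq_mul_inv]; ring,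
    ENNReal.le_div_iff_mul_le (Or.inl h2) (Or.inl h2t), mul_comm]
  exact h

/-- Reverse doubling: in positive dimension a cube fills at most half of its double, so the halving
bound iterates along the dilates. -/
theorem HalvingBound.measure_cube_le_pow_mul {μ : Measure (EuclideanSpace ℝ (Fin n))} {η : ℝ≥0∞}
    (hη : HalvingBound μ η) (hn : n ≠ 0) (x : EuclideanSpace ℝ (Fin n)) {ℓ : ℝ} (hℓ : 0 < ℓ)
    (j : ℕ) : μ (cube x ℓ) ≤ η ^ j * μ (cube x (2 ^ j * ℓ)) := by
  induction j with
  | zero => simp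
  | succ j ih =>
    have hj : 0 < 2 ^ j * ℓ := by positivity
    have h := hη x (2 * (2 ^ j * ℓ)) (by positivity) (cube x (2 ^ j * ℓ))
      (cube_subset_cube x (by linarith)) (measurableSet_cube _ _) (by
        rw [volume_cube_two_mul x hj.le]
        gcongr
        exact le_self_pow₀ one_le_two hn)
    calc μ (cube x ℓ) ≤ η ^ j * μ (cube x (2 ^ j * ℓ)) := ih
      _ ≤ η ^ j * (η * μ (cube x (2 * (2 ^ j * ℓ)))) := by gcongr
      _ = _ := by rw [← mul_assoc, ← pow_succ, ← mul_assoc, ← pow_succ']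

end Muckenhoupt

/-! ### Duality between the logarithmic bump and exponential integrability. -/

section LogBump

variable {n : ℕ} {𝕜 : Type*} [RCLike 𝕜]

theorem le_mul_exp_div {M : ℝ} (hM : 0 < M) (B : ℝ) : B ≤ M * Real.exp (B / M) := by
  have h := Real.add_one_le_exp (B / M)
  calc B = M * (B / M) := by field_simp
    _ ≤ M * Real.exp (B / M) := by gcongr; linarith

/-- A Young-type inequality between `t ↦ (t log (e + t)) ^ s` and the exponential function. -/
theorem mul_rpow_le_rpow_mul_add_exp {s c B t : ℝ} (hs : 0 < s) (hc : 0 < c) (hB : 0 ≤ B)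
    (ht : 0 ≤ t) : (B * t) ^ s ≤ (2 * s / c) ^ s *
      (t ^ s * Real.log (Real.exp 1 + t) ^ s + Real.exp (c * B)) := by
  set M := 2 * s / c with hMdef
  have hM : 0 < M := by positivity
  have he : 1 ≤ Real.exp 1 + t := by
    have := Real.add_one_le_exp 1; linarith
  have hlog : 0 ≤ Real.log (Real.exp 1 + t) := Real.log_nonneg he
  -- Either `B` is dominated by the logarithm, giving the bump term, or `t ≤ exp (B / M)`. In the
  -- second case `B * t ≤ M * exp (2 * B / M)`, and `M = 2 * s / c` makes its `s`-th power a
  -- multiple of `exp (c * B)`.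
  rcases le_or_gt B (M * Real.log (Real.exp 1 + t)) with h | h
  · calc (B * t) ^ s ≤ (M * Real.log (Real.exp 1 + t) * t) ^ s := by gcongr
      _ = M ^ s * (t ^ s * Real.log (Real.exp 1 + t) ^ s) := by
          rw [Real.mul_rpow (by positivity) ht, Real.mul_rpow hM.le hlog]; ring
      _ ≤ _ := by gcongr; linarith [Real.exp_pos (c * B)]
  · have ht' : t ≤ Real.exp (B / M) := by
      rw [← lt_div_iff₀' hM, Real.log_lt_iff_lt_exp (by linarith)] at h
      linarith [Real.exp_pos 1]
    calc (B * t) ^ s ≤ (M * Real.exp (B / M) * Real.exp (B / M)) ^ s := by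
          gcongr; exact le_mul_exp_div hM B
      _ = M ^ s * Real.exp (c * B) := by
          rw [mul_assoc, ← Real.exp_add, Real.mul_rpow hM.le (Real.exp_pos _).le, ← Real.exp_mul]
          congr 2
          rw [hMdef]; field_simp; ring
      _ ≤ _ := by gcongr; linarith [show 0 ≤ t ^ s * Real.log (Real.exp 1 + t) ^ s by positivity]

theorem mul_rpow_le_logBump_add_exp {s c B : ℝ} (hs : 0 < s) (hc : 0 < c) (hB : 0 ≤ B)
    (t : ℝ≥0∞) : (ENNReal.ofReal B * t) ^ s ≤ ENNReal.ofReal ((2 * s / c) ^ s) *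
      (logBump s t + ENNReal.ofReal (Real.exp (c * B))) := by
  rcases eq_or_ne t ∞ with rfl | ht
  · have : 0 < (2 * s / c) ^ s := by positivity
    simp [logBump, ENNReal.mul_top, this]
  · lift t to ℝ≥0 using ht
    rw [logBump, if_neg ENNReal.coe_ne_top, ENNReal.coe_toReal]
    have hlog : 0 ≤ Real.log (Real.exp 1 + t) := Real.log_nonneg (by
      have := Real.add_one_le_exp 1; have := t.2; linarith)
    rw [← ENNReal.ofReal_add (by positivity) (by positivity), ← ENNReal.ofReal_mul (by positivity),
      ← ENNReal.ofReal_coe_nnreal (p := t), ← ENNReal.ofReal_mul hB,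
      ENNReal.ofReal_rpow_of_nonneg (by positivity) hs.le]
    exact ENNReal.ofReal_le_ofReal (mul_rpow_le_rpow_mul_add_exp hs hc hB t.2)

theorem enorm_add_one_eq_ofReal (z : 𝕜) : ‖z‖ₑ + 1 = ENNReal.ofReal (‖z‖ + 1) := by
  rw [ENNReal.ofReal_add (norm_nonneg _) zero_le_one, ofReal_norm, ENNReal.ofReal_one]

/-- The generalized Hölder inequality for a function in `BMO` and the bump `logBump s`. -/
theorem MemBMO.exists_mean_rpow_le_luxemburgNorm {b : EuclideanSpace ℝ (Fin n) → 𝕜}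
    (hb : MemBMO b) {s : ℝ} (hs : 0 < s) :
    ∃ K : ℝ≥0∞, K ≠ 0 ∧ K ≠ ∞ ∧ ∀ (x : EuclideanSpace ℝ (Fin n)) (ℓ : ℝ), 0 < ℓ →
      ∀ u : EuclideanSpace ℝ (Fin n) → ℝ≥0∞,
        mean (cube x ℓ) (fun y => ((‖b y - ⨍ z in cube x ℓ, b z‖ₑ + 1) * u y) ^ s) ^ (1 / s)
          ≤ K * luxemburgNorm (logBump s) (cube x ℓ) u := by
  obtain ⟨c, hc, K, hK, hexp⟩ := halvingBound_volume.exists_lintegral_exp_le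
    (by simp) Measure.AbsolutelyContinuous.rfl hb
  set M := ENNReal.ofReal ((2 * s / c) ^ s) with hM
  have hM0 : M ≠ 0 := by
    rw [hM, Ne, ENNReal.ofReal_eq_zero, not_le]; positivity
  set K₁ : ℝ≥0∞ := M * (1 + ENNReal.ofReal (Real.exp c) * K)
  have hK₁0 : K₁ ≠ 0 := mul_ne_zero hM0 (by positivity)
  have hK₁t : K₁ ≠ ∞ := by simp only [K₁, M]; finiteness
  have hK₂0 : K₁ ^ (1 / s) ≠ 0 := (ENNReal.rpow_pos (pos_iff_ne_zero.2 hK₁0) hK₁t).ne'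
  have hK₂t : K₁ ^ (1 / s) ≠ ∞ := ENNReal.rpow_ne_top_of_nonneg (by positivity) hK₁t
  refine ⟨K₁ ^ (1 / s), hK₂0, hK₂t, fun x ℓ hℓ u => ?_⟩
  have hV0 := volume_cube_ne_zero x hℓ
  have hVt := volume_cube_ne_top x hℓ.le
  set a := ⨍ z in cube x ℓ, b z
  have hexp_mean : mean (cube x ℓ) (fun y => ENNReal.ofReal (Real.exp (c * (‖b y - a‖ + 1))))
      ≤ ENNReal.ofReal (Real.exp c) * K := by
    have e : ∀ y, ENNReal.ofReal (Real.exp (c * (‖b y - a‖ + 1)))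
        = ENNReal.ofReal (Real.exp c) * ENNReal.ofReal (Real.exp (c * ‖b y - a‖)) := fun y => by
      rw [← ENNReal.ofReal_mul (Real.exp_pos _).le, ← Real.exp_add]; congr 2; ring
    simp only [e, mean]
    rw [lintegral_const_mul' _ _ ENNReal.ofReal_ne_top]
    calc _ ≤ (volume (cube x ℓ))⁻¹ * (ENNReal.ofReal (Real.exp c) * (K * volume (cube x ℓ))) := by
          gcongr; exact hexp x ℓ hℓ
      _ = ENNReal.ofReal (Real.exp c) * K * ((volume (cube x ℓ))⁻¹ * volume (cube x ℓ)) := by ring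
      _ = _ := by rw [ENNReal.inv_mul_cancel hV0 hVt, mul_one]
  rw [mul_comm, ← ENNReal.div_le_iff_le_mul (Or.inl hK₂0) (Or.inl hK₂t)]
  -- It suffices to treat every admissible `t` in the infimum defining the Luxemburg norm.
  refine le_sInf fun t ⟨ht0, htt, ht⟩ => ?_
  rw [ENNReal.div_le_iff_le_mul (Or.inl hK₂0) (Or.inl hK₂t)]
  have hts0 : t ^ s ≠ ∞ := ENNReal.rpow_ne_top_of_nonneg hs.le htt.ne
  have hmeas : AEMeasurable (fun y => ENNReal.ofReal (Real.exp (c * (‖b y - a‖ + 1))))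
      (volume.restrict (cube x ℓ)) := by
    have := (hb.1.aestronglyMeasurable.sub
      (aestronglyMeasurable_const (b := a))).norm.aemeasurable.restrict (s := cube x ℓ)
    exact (Real.measurable_exp.comp_aemeasurable ((this.add_const 1).const_mul c)).ennreal_ofReal
  have hbound : mean (cube x ℓ) (fun y => ((‖b y - a‖ₑ + 1) * u y) ^ s) ≤ t ^ s * K₁ := by
    calc _ ≤ mean (cube x ℓ) (fun y => t ^ s * (M * (logBump s (u y / t) +
          ENNReal.ofReal (Real.exp (c * (‖b y - a‖ + 1)))))) := by
          refine mean_mono fun y => ?_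
          rw [enorm_add_one_eq_ofReal]
          calc _ = t ^ s * (ENNReal.ofReal (‖b y - a‖ + 1) * (u y / t)) ^ s := by
                rw [← ENNReal.mul_rpow_of_nonneg _ _ hs.le, mul_left_comm,
                  ENNReal.mul_div_cancel ht0.ne' htt.ne]
            _ ≤ _ := by
                gcongr
                exact mul_rpow_le_logBump_add_exp hs hc (by positivity) _
      _ = t ^ s * (M * (mean (cube x ℓ) (fun y => logBump s (u y / t)) +
          mean (cube x ℓ) (fun y => ENNReal.ofReal (Real.exp (c * (‖b y - a‖ + 1)))))) := by
          simp only [mean]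
          rw [lintegral_const_mul' _ _ hts0, lintegral_const_mul' _ _ ENNReal.ofReal_ne_top,
            lintegral_add_right' _ hmeas]
          ring
      _ ≤ _ := by
          simp only [K₁]
          gcongr
  calc _ ≤ (t ^ s * K₁) ^ (1 / s) := by gcongr
    _ = _ := by
      rw [ENNReal.mul_rpow_of_nonneg _ _ (by positivity), ← ENNReal.rpow_mul,
        mul_one_div_cancel hs.ne', ENNReal.rpow_one]

/-- All powers of the oscillation of a function in `BMO` are integrable with respect to a measure
satisfying a halving bound. -/
theorem HalvingBound.exists_lintegral_rpow_le {μ : Measure (EuclideanSpace ℝ (Fin n))} {η : ℝ≥0∞}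
    (hη : HalvingBound μ η) (hη1 : η < 1) (hμ : μ ≪ volume) {b : EuclideanSpace ℝ (Fin n) → 𝕜}
    (hb : MemBMO b) {p : ℝ} (hp : 0 < p) :
    ∃ K : ℝ≥0∞, K ≠ ∞ ∧ ∀ (x : EuclideanSpace ℝ (Fin n)) (ℓ : ℝ), 0 < ℓ →
      ∫⁻ y in cube x ℓ, (‖b y - ⨍ z in cube x ℓ, b z‖ₑ + 1) ^ p ∂μ ≤ K * μ (cube x ℓ) := by
  obtain ⟨c, hc, K, hK, hexp⟩ := hη.exists_lintegral_exp_le hη1 hμ hb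
  have hM : 0 < p / c := by positivity
  refine ⟨ENNReal.ofReal ((p / c) ^ p * Real.exp c) * K, by finiteness, fun x ℓ hℓ => ?_⟩
  rw [mul_assoc]
  refine le_trans ?_ (mul_le_mul_right (hexp x ℓ hℓ) _)
  rw [← lintegral_const_mul' _ _ ENNReal.ofReal_ne_top]
  refine lintegral_mono fun y => ?_
  set B := ‖b y - ⨍ z in cube x ℓ, b z‖
  rw [enorm_add_one_eq_ofReal, ENNReal.ofReal_rpow_of_nonneg (by positivity) hp.le,
    ← ENNReal.ofReal_mul (by positivity)]
  refine ENNReal.ofReal_le_ofReal ?_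
  calc (B + 1) ^ p ≤ (p / c * Real.exp ((B + 1) / (p / c))) ^ p := by
        gcongr; exact le_mul_exp_div hM _
    _ = (p / c) ^ p * Real.exp c * Real.exp (c * B) := by
        rw [Real.mul_rpow hM.le (Real.exp_pos _).le, ← Real.exp_mul, mul_assoc, ← Real.exp_add]
        congr 2
        field_simp; ring

end LogBump

/-! ### The bump condition and the estimate on a single cube. -/

section Bump

variable {n : ℕ} {𝕜 : Type*} [RCLike 𝕜] {p κ γ r : ℝ} {w ν : EuclideanSpace ℝ (Fin n) → ℝ}

theorem mean_le_mean_rpow_rpow_inv {g : EuclideanSpace ℝ (Fin n) → ℝ≥0∞}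
    (hg : AEMeasurable g volume) (x : EuclideanSpace ℝ (Fin n)) {ℓ : ℝ} (hℓ : 0 < ℓ) (hr : 1 < r) :
    mean (cube x ℓ) g ≤ mean (cube x ℓ) (fun y => g y ^ r) ^ (1 / r) := by
  have hr' : r.HolderConjugate r.conjExponent := Real.HolderConjugate.conjExponent hr
  have h := ENNReal.lintegral_mul_le_Lp_mul_Lq (volume.restrict (cube x ℓ)) hr' hg.restrict
    (aemeasurable_const (b := (1 : ℝ≥0∞)))
  simp only [Pi.mul_apply, mul_one, ENNReal.one_rpow, lintegral_one,
    Measure.restrict_apply_univ] at h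
  set V := volume (cube x ℓ)
  have hV0 : V ≠ 0 := volume_cube_ne_zero x hℓ
  have hVt : V ≠ ∞ := volume_cube_ne_top x hℓ.le
  rw [mean, mean, ENNReal.mul_rpow_of_nonneg _ _ (one_div_pos.2 hr'.pos).le]
  calc V⁻¹ * ∫⁻ y in cube x ℓ, g y
      ≤ V⁻¹ * ((∫⁻ y in cube x ℓ, g y ^ r) ^ (1 / r) * V ^ (1 / r.conjExponent)) := by gcongr
    _ = V⁻¹ ^ (1 / r) * (∫⁻ y in cube x ℓ, g y ^ r) ^ (1 / r) := by
      have : V⁻¹ ^ (1 / r) = V⁻¹ * V ^ (1 / r.conjExponent) := by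
        rw [← ENNReal.rpow_neg_one, ← ENNReal.rpow_mul, ← ENNReal.rpow_add _ _ hV0 hVt]
        congr 1
        have := hr'.inv_add_inv_eq_one
        simp only [one_div]; linarith
      rw [this]; ring

/-- The bump condition with the plain mean of `w` in place of its `r`-th power mean. -/
theorem FracBump.exists_rpow_mul_luxemburgNorm_le (hp : 1 < p) (hr : 1 < r)
    (hbump : FracBump γ p r w ν) (hw : IsWeight w) (hpos : ∀ᵐ x, 0 < w x) :
    ∃ C : ℝ≥0∞, C ≠ ∞ ∧ ∀ (x : EuclideanSpace ℝ (Fin n)) (ℓ : ℝ), 0 < ℓ →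
      volume (cube x ℓ) ^ (γ / n - 1) * volume (cube x ℓ) ^ (1 / p.conjExponent)
        * luxemburgNorm (logBump p.conjExponent) (cube x ℓ)
          (fun y => ENNReal.ofReal (ν y) ^ (-(1 / p)))
        ≤ C * wMeasure w (cube x ℓ) ^ (-(1 / p)) := by
  obtain ⟨C, hC⟩ := hbump
  have hp' : p.HolderConjugate p.conjExponent := Real.HolderConjugate.conjExponent hp
  refine ⟨C, ENNReal.coe_ne_top, fun x ℓ hℓ => ?_⟩
  have h := hC x ℓ hℓ
  set L := luxemburgNorm (logBump p.conjExponent) (cube x ℓ)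
          (fun y => ENNReal.ofReal (ν y) ^ (-(1 / p)))
  set V := volume (cube x ℓ)
  have hV0 : V ≠ 0 := volume_cube_ne_zero x hℓ
  have hVt : V ≠ ∞ := volume_cube_ne_top x hℓ.le
  set W := wMeasure w (cube x ℓ) with hW
  have hW0 : W ≠ 0 := wMeasure_cube_ne_zero hw hpos x hℓ
  have hWt : W ≠ ∞ := wMeasure_cube_ne_top hw x ℓ
  have hmean : (V⁻¹ * W) ^ (1 / p)
      ≤ mean (cube x ℓ) (fun y => ENNReal.ofReal (w y) ^ r) ^ (1 / (r * p)) := by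
    have h1 := mean_le_mean_rpow_rpow_inv hw.aemeasurable x hℓ hr
    rw [mean, ← wMeasure_cube] at h1
    refine (ENNReal.rpow_le_rpow h1 (one_div_pos.2 hp'.pos).le).trans ?_
    rw [← ENNReal.rpow_mul, one_div_mul_one_div]
  have h2 : V ^ (γ / n) * (V⁻¹ * W) ^ (1 / p) * L ≤ C := le_trans (by gcongr) h
  have hWW : W ^ (1 / p) * W ^ (-(1 / p)) = 1 := by
    rw [← ENNReal.rpow_add _ _ hW0 hWt, add_neg_cancel, ENNReal.rpow_zero]
  -- Exponent count: `γ/n - 1 + 1/p' = γ/n - 1/p`.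
  have hVV : V ^ (γ / n - 1) * V ^ (1 / p.conjExponent) = V ^ (γ / n) * V⁻¹ ^ (1 / p) := by
    rw [← ENNReal.rpow_neg_one V, ← ENNReal.rpow_mul, ← ENNReal.rpow_add _ _ hV0 hVt,
      ← ENNReal.rpow_add _ _ hV0 hVt]
    congr 1
    have := hp'.inv_add_inv_eq_one
    simp only [one_div]; linarith
  calc _ = V ^ (γ / n) * (V⁻¹ ^ (1 / p) * (W ^ (1 / p) * W ^ (-(1 / p)))) * L := by
        rw [hVV, hWW, mul_one]
    _ = V ^ (γ / n) * (V⁻¹ * W) ^ (1 / p) * L * W ^ (-(1 / p)) := by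
        rw [ENNReal.mul_rpow_of_nonneg _ _ (one_div_pos.2 hp'.pos).le]; ring
    _ ≤ _ := by gcongr

theorem setLIntegral_le_morreyNorm (hp : 0 < p) (hw : IsWeight w)
    (hpos : ∀ᵐ x, 0 < w x) (f : EuclideanSpace ℝ (Fin n) → 𝕜) (x : EuclideanSpace ℝ (Fin n))
    {ℓ : ℝ} (hℓ : 0 < ℓ) :
    (∫⁻ y in cube x ℓ, ‖f y‖ₑ ^ p * ENNReal.ofReal (ν y)) ≤
      morreyNorm p κ ν w f ^ p * wMeasure w (cube x ℓ) ^ κ := by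
  have hW0 : wMeasure w (cube x ℓ) ^ κ ≠ 0 := (ENNReal.rpow_pos
    (pos_iff_ne_zero.2 (wMeasure_cube_ne_zero hw hpos x hℓ)) (wMeasure_cube_ne_top hw x ℓ)).ne'
  have hWt : wMeasure w (cube x ℓ) ^ κ ≠ ∞ :=
    ENNReal.rpow_ne_top_of_ne_zero (wMeasure_cube_ne_zero hw hpos x hℓ)
      (wMeasure_cube_ne_top hw x ℓ)
  have h : ((wMeasure w (cube x ℓ) ^ κ)⁻¹
      * ∫⁻ y in cube x ℓ, ‖f y‖ₑ ^ p * ENNReal.ofReal (ν y)) ^ (1 / p) ≤ morreyNorm p κ ν w f :=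
    le_iSup_of_le x (le_iSup_of_le ℓ (le_iSup_of_le hℓ le_rfl))
  rw [one_div, ENNReal.rpow_inv_le_iff hp, mul_comm, ← div_eq_mul_inv,
    ENNReal.div_le_iff_le_mul (Or.inl hW0) (Or.inl hWt)] at h
  exact h

/-- The local estimate on one cube: bump condition, generalized Hölder inequality and Morrey
norm combined. -/
theorem exists_rpow_mul_setLIntegral_le {b : EuclideanSpace ℝ (Fin n) → 𝕜} (hb : MemBMO b)
    (hp : 1 < p) (hr : 1 < r) (hbump : FracBump γ p r w ν) (hw : IsWeight w) (hν : IsWeight ν)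
    (hpos : ∀ᵐ x, 0 < w x) :
    ∃ C : ℝ≥0∞, C ≠ ∞ ∧ ∀ f : EuclideanSpace ℝ (Fin n) → 𝕜, AEStronglyMeasurable f volume →
      ∀ (x : EuclideanSpace ℝ (Fin n)) (ℓ : ℝ), 0 < ℓ →
        volume (cube x ℓ) ^ (γ / n - 1)
          * ∫⁻ y in cube x ℓ, (‖b y - ⨍ z in cube x ℓ, b z‖ₑ + 1) * ‖f y‖ₑ
          ≤ C * morreyNorm p κ ν w f * wMeasure w (cube x ℓ) ^ ((κ - 1) / p) := by
  have hp' : p.HolderConjugate p.conjExponent := Real.HolderConjugate.conjExponent hp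
  obtain ⟨C, hCt, hC⟩ := hbump.exists_rpow_mul_luxemburgNorm_le hp hr hw hpos
  obtain ⟨K, hK0, hKt, hK⟩ := hb.exists_mean_rpow_le_luxemburgNorm hp'.symm.pos
  refine ⟨C * K, by finiteness, fun f hf x ℓ hℓ => ?_⟩
  have hC := hC x ℓ hℓ
  have hK := hK x ℓ hℓ (fun y => ENNReal.ofReal (ν y) ^ (-(1 / p)))
  set L := luxemburgNorm (logBump p.conjExponent) (cube x ℓ)
          (fun y => ENNReal.ofReal (ν y) ^ (-(1 / p)))
  set V := volume (cube x ℓ) with hV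
  have hV0 : V ≠ 0 := volume_cube_ne_zero x hℓ
  have hVt : V ≠ ∞ := volume_cube_ne_top x hℓ.le
  have hW0 : wMeasure w (cube x ℓ) ≠ 0 := wMeasure_cube_ne_zero hw hpos x hℓ
  have hWt : wMeasure w (cube x ℓ) ≠ ∞ := wMeasure_cube_ne_top hw x ℓ
  have hM := setLIntegral_le_morreyNorm (κ := κ) (ν := ν) hp'.pos hw hpos f x hℓ
  set W := wMeasure w (cube x ℓ)
  set N := morreyNorm p κ ν w f
  set B : EuclideanSpace ℝ (Fin n) → ℝ≥0∞ := fun y => ‖b y - ⨍ z in cube x ℓ, b z‖ₑ + 1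
  have hBm : AEMeasurable B volume :=
    (hb.1.aestronglyMeasurable.sub aestronglyMeasurable_const).enorm.add_const 1
  have hνm := hν.aemeasurable
  have hLt : L ≠ ∞ := by
    intro hL
    rw [hL, ENNReal.mul_top] at hC
    · exact absurd (top_le_iff.1 hC)
        (ENNReal.mul_ne_top hCt (ENNReal.rpow_ne_top_of_ne_zero hW0 hWt))
    · exact mul_ne_zero (ENNReal.rpow_pos (pos_iff_ne_zero.2 hV0) hVt).ne'
        (ENNReal.rpow_pos (pos_iff_ne_zero.2 hV0) hVt).ne'
  set J := ∫⁻ y in cube x ℓ, (B y * ENNReal.ofReal (ν y) ^ (-(1 / p))) ^ p.conjExponent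
  have hJ : J ^ (1 / p.conjExponent) ≤ V ^ (1 / p.conjExponent) * (K * L) := by
    have e : J = V * mean (cube x ℓ)
        (fun y => (B y * ENNReal.ofReal (ν y) ^ (-(1 / p))) ^ p.conjExponent) := by
      rw [mean, ← mul_assoc, ENNReal.mul_inv_cancel hV0 hVt, one_mul]
    rw [e, ENNReal.mul_rpow_of_nonneg _ _ (one_div_pos.2 hp'.symm.pos).le]
    gcongr
  have hJt : J ≠ ∞ := by
    intro h
    rw [h, ENNReal.top_rpow_of_pos (one_div_pos.2 hp'.symm.pos), top_le_iff] at hJ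
    exact ENNReal.mul_ne_top (ENNReal.rpow_ne_top_of_nonneg (one_div_pos.2 hp'.symm.pos).le hVt)
      (ENNReal.mul_ne_top hKt hLt) hJ
  -- Since `B ≥ 1`, finiteness of `J` excludes `ν = 0` on a set of positive measure; this justifies
  -- inserting `1 = ν^(1/p) ν^(-1/p)`.
  have hνpos : ∀ᵐ y ∂volume.restrict (cube x ℓ), 0 < ν y := by
    filter_upwards [ae_lt_top' ((hBm.mul (hνm.pow_const _)).pow_const _).restrict hJt] with y hy
    by_contra hy0
    rw [Pi.mul_apply, ENNReal.ofReal_of_nonpos (not_lt.1 hy0),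
      ENNReal.zero_rpow_of_neg (neg_neg_of_pos (one_div_pos.2 hp'.pos)),
      ENNReal.mul_top (by simp [B]), ENNReal.top_rpow_of_pos hp'.symm.pos] at hy
    exact lt_irrefl _ hy
  have hholder : ∫⁻ y in cube x ℓ, B y * ‖f y‖ₑ ≤ (N ^ p * W ^ κ) ^ (1 / p) *
      J ^ (1 / p.conjExponent) := by
    calc ∫⁻ y in cube x ℓ, B y * ‖f y‖ₑ
        = ∫⁻ y in cube x ℓ, (‖f y‖ₑ * ENNReal.ofReal (ν y) ^ (1 / p))
            * (B y * ENNReal.ofReal (ν y) ^ (-(1 / p))) := by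
          refine lintegral_congr_ae ?_
          filter_upwards [hνpos] with y hy
          calc B y * ‖f y‖ₑ = B y * ‖f y‖ₑ *
                (ENNReal.ofReal (ν y) ^ (1 / p) * ENNReal.ofReal (ν y) ^ (-(1 / p))) := by
                rw [← ENNReal.rpow_add _ _ (by simpa using hy) ENNReal.ofReal_ne_top,
                  add_neg_cancel, ENNReal.rpow_zero, mul_one]
            _ = _ := by ring
      _ ≤ (∫⁻ y in cube x ℓ, (‖f y‖ₑ * ENNReal.ofReal (ν y) ^ (1 / p)) ^ p) ^ (1 / p)
            * J ^ (1 / p.conjExponent) :=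
          ENNReal.lintegral_mul_le_Lp_mul_Lq _ hp' (hf.enorm.mul (hνm.pow_const _)).restrict
            (hBm.mul (hνm.pow_const _)).restrict
      _ ≤ _ := by
          have e : ∀ y, (‖f y‖ₑ * ENNReal.ofReal (ν y) ^ (1 / p)) ^ p
              = ‖f y‖ₑ ^ p * ENNReal.ofReal (ν y) := fun y => by
            rw [ENNReal.mul_rpow_of_nonneg _ _ hp'.pos.le, ← ENNReal.rpow_mul,
              one_div_mul_cancel hp'.ne_zero, ENNReal.rpow_one]
          simp only [e]
          have := hp'.pos
          gcongr
  have hNW : (N ^ p * W ^ κ) ^ (1 / p) = N * W ^ (κ / p) := by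
    rw [ENNReal.mul_rpow_of_nonneg _ _ (one_div_pos.2 hp'.pos).le, ← ENNReal.rpow_mul,
      ← ENNReal.rpow_mul, mul_one_div_cancel hp'.ne_zero, ENNReal.rpow_one, mul_one_div]
  calc V ^ (γ / n - 1) * ∫⁻ y in cube x ℓ, B y * ‖f y‖ₑ
      ≤ V ^ (γ / n - 1) * (N * W ^ (κ / p) * (V ^ (1 / p.conjExponent) * (K * L))) := by
        rw [hNW] at hholder
        gcongr
        exact hholder.trans (by gcongr)
    _ = (V ^ (γ / n - 1) * V ^ (1 / p.conjExponent) * L) * (K * N * W ^ (κ / p)) := by ring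
    _ ≤ C * W ^ (-(1 / p)) * (K * N * W ^ (κ / p)) := by gcongr
    _ = C * K * N * (W ^ (-(1 / p)) * W ^ (κ / p)) := by ring
    _ = _ := by
        rw [← ENNReal.rpow_add _ _ hW0 hWt]
        congr 2
        ring

end Bump

/-! ### The part of the function far from the cube. -/

section Tail

variable {n : ℕ} {𝕜 : Type*} [RCLike 𝕜] {p κ γ r : ℝ} {w ν : EuclideanSpace ℝ (Fin n) → ℝ}

theorem exists_mem_cube_two_pow (x y : EuclideanSpace ℝ (Fin n)) {ℓ : ℝ} (hℓ : 0 < ℓ) :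
    ∃ m : ℕ, y ∈ cube x (2 ^ m * ℓ) := by
  obtain ⟨m, hm⟩ := pow_unbounded_of_one_lt (2 * ‖y - x‖ / ℓ) (one_lt_two)
  refine ⟨m, fun i => ?_⟩
  have := PiLp.norm_apply_le (y - x) i
  rw [PiLp.sub_apply, Real.norm_eq_abs] at this
  rw [div_lt_iff₀ hℓ] at hm
  linarith

/-- Decomposition of the fractional integral of a function supported away from a cube into
averages over the dyadic dilates of that cube. -/
theorem lintegral_fractional_indicator_compl_cube_le (hn : n ≠ 0) (hγn : γ < n)
    {b f : EuclideanSpace ℝ (Fin n) → 𝕜} (hb : AEStronglyMeasurable b volume)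
    (hf : AEStronglyMeasurable f volume) (x₀ : EuclideanSpace ℝ (Fin n)) {ℓ : ℝ} (hℓ : 0 < ℓ)
    {x : EuclideanSpace ℝ (Fin n)} (hx : x ∈ cube x₀ ℓ) :
    ∫⁻ y, ‖b x - b y‖ₑ * ‖(cube x₀ (2 * ℓ))ᶜ.indicator f y‖ₑ / ‖x - y‖ₑ ^ ((n : ℝ) - γ) ≤
      8 ^ ((n : ℝ) - γ) * ∑' m : ℕ, volume (cube x₀ (2 ^ m * ℓ)) ^ (γ / n - 1) *
        ∫⁻ y in cube x₀ (2 ^ m * ℓ), ‖b x - b y‖ₑ * ‖f y‖ₑ := by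
  have hnγ : 0 < (n : ℝ) - γ := by linarith
  have hn' : (n : ℝ) ≠ 0 := Nat.cast_ne_zero.2 hn
  set g : EuclideanSpace ℝ (Fin n) → ℝ≥0∞ := fun y => ‖b x - b y‖ₑ * ‖f y‖ₑ with hg
  have hgm : AEMeasurable g volume := (aestronglyMeasurable_const.sub hb).enorm.mul hf.enorm
  set a : ℕ → ℝ≥0∞ := fun m => 8 ^ ((n : ℝ) - γ) * volume (cube x₀ (2 ^ m * ℓ)) ^ (γ / n - 1)
  calc _ ≤ ∫⁻ y, ∑' m : ℕ, (cube x₀ (2 ^ m * ℓ)).indicator (fun y => a m * g y) y := by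
        refine lintegral_mono fun y => ?_
        by_cases hy : y ∈ cube x₀ (2 * ℓ)
        · simp [hy]
        have hex := exists_mem_cube_two_pow x₀ y hℓ
        classical
        -- The least dilate containing `y`. As `y ∉ 2Q`, `m ≥ 2`, so `y` lies outside `2^(m-1) Q ⊇
        -- 2Q`; the separation `2^(m-1) ℓ / 4` is the source of the 8.
        set m := Nat.find hex with hm
        have hmem : y ∈ cube x₀ (2 ^ m * ℓ) := Nat.find_spec hex
        have hm2 : 2 ≤ m := by
          by_contra hlt
          refine hy (cube_subset_cube x₀ ?_ hmem)
          gcongr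
          calc (2 : ℝ) ^ m ≤ 2 ^ 1 := pow_le_pow_right₀ one_le_two (by omega)
            _ = 2 := pow_one 2
        obtain ⟨k, hk⟩ : ∃ k, m = k + 1 := ⟨m - 1, by omega⟩
        have hnot : y ∉ cube x₀ (2 ^ k * ℓ) := Nat.find_min hex (by omega)
        have hdist : 2 ^ m * ℓ / 8 ≤ ‖x - y‖ := by
          have h2k : (2 : ℝ) ≤ 2 ^ k := by
            calc (2 : ℝ) = 2 ^ 1 := (pow_one 2).symm
              _ ≤ 2 ^ k := pow_le_pow_right₀ one_le_two (by omega)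
          have := le_norm_sub_of_mem_cube (by gcongr) hx hnot
          rw [hk, pow_succ]
          linarith
        refine le_trans ?_ (ENNReal.le_tsum m)
        rw [indicator_of_mem hmem, indicator_of_mem (show y ∈ (cube x₀ (2 * ℓ))ᶜ from hy),
          div_eq_mul_inv, mul_comm]
        gcongr
        have hs : 0 < 2 ^ m * ℓ := by positivity
        have hdist' : ENNReal.ofReal (2 ^ m * ℓ) / 8 ≤ ‖x - y‖ₑ := by
          rw [← ofReal_norm, ← ENNReal.ofReal_ofNat, ← ENNReal.ofReal_div_of_pos (by norm_num)]
          exact ENNReal.ofReal_le_ofReal hdist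
        have hs0 : ENNReal.ofReal (2 ^ m * ℓ) ≠ 0 := by simpa using hs
        calc (‖x - y‖ₑ ^ ((n : ℝ) - γ))⁻¹
            ≤ ((ENNReal.ofReal (2 ^ m * ℓ) / 8) ^ ((n : ℝ) - γ))⁻¹ := by gcongr
          _ = a m := by
            simp only [a]
            rw [volume_cube _ hs.le, ← ENNReal.inv_rpow, ENNReal.inv_div (Or.inl (by simp))
              (Or.inl (by simp)), div_eq_mul_inv, ENNReal.mul_rpow_of_nonneg _ _ hnγ.le,
              ENNReal.inv_rpow, ← ENNReal.rpow_neg, ← ENNReal.rpow_natCast, ← ENNReal.rpow_mul]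
            congr 2
            field_simp; ring
    _ = ∑' m : ℕ, ∫⁻ y, (cube x₀ (2 ^ m * ℓ)).indicator (fun y => a m * g y) y :=
        lintegral_tsum fun m => (hgm.const_mul _).indicator (measurableSet_cube _ _)
    _ = ∑' m : ℕ, a m * ∫⁻ y in cube x₀ (2 ^ m * ℓ), g y := by
        congr 1; ext m
        rw [lintegral_indicator (measurableSet_cube _ _), lintegral_const_mul'' _ hgm.restrict]
    _ = _ := by simp only [a, mul_assoc, ENNReal.tsum_mul_left]

/-- Telescoping over successive doublings, each costing `2 ^ n` times the seminorm. -/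
theorem enorm_setAverage_sub_setAverage_dilate_le {b : EuclideanSpace ℝ (Fin n) → 𝕜}
    (hb : LocallyIntegrable b volume) (x : EuclideanSpace ℝ (Fin n)) {ℓ : ℝ} (hℓ : 0 < ℓ) (m : ℕ) :
    ‖(⨍ z in cube x ℓ, b z) - ⨍ z in cube x (2 ^ m * ℓ), b z‖ₑ ≤ m * (2 ^ n * bmoSeminorm b) := by
  induction m with
  | zero => simp
  | succ m ih =>
    have hm : 0 < 2 ^ m * ℓ := by positivity
    have e : (2 : ℝ) ^ (m + 1) * ℓ = 2 * (2 ^ m * ℓ) := by ring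
    have h : ‖(⨍ z in cube x (2 ^ m * ℓ), b z) - ⨍ z in cube x (2 ^ (m + 1) * ℓ), b z‖ₑ
        ≤ 2 ^ n * bmoSeminorm b := by
      refine (enorm_setAverage_sub_le_mean hb x hm _).trans ?_
      rw [e]
      refine (mean_le_mul_mean (cube_subset_cube x (by linarith)) (by positivity) (by finiteness)
        (volume_cube_two_mul x hm.le) _).trans ?_
      gcongr
      exact mean_le_bmoSeminorm b x (by positivity)
    rw [← sub_add_sub_cancel _ (⨍ z in cube x (2 ^ m * ℓ), b z), Nat.cast_succ, add_mul, one_mul]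
    exact (enorm_add_le _ _).trans (add_le_add ih h)

theorem tsum_natCast_mul_add_one_mul_pow_ne_top {D θ : ℝ≥0∞} (hD : D ≠ ∞) (hθ : θ < 1) :
    ∑' m : ℕ, (m * D + 1) * θ ^ m ≠ ∞ := by
  lift D to ℝ≥0 using hD
  lift θ to ℝ≥0 using (hθ.trans_le le_top).ne
  have hθ' : ‖(θ : ℝ)‖ < 1 := by
    rw [Real.norm_of_nonneg θ.coe_nonneg]; exact_mod_cast hθ
  have h1 := (summable_pow_mul_geometric_of_norm_lt_one 1 hθ').mul_left (D : ℝ)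
  have h2 := h1.add (summable_geometric_of_norm_lt_one hθ')
  have h3 : Summable fun m : ℕ => ((m : ℝ≥0) * D + 1) * θ ^ m := by
    rw [← NNReal.summable_coe]
    refine h2.congr fun m => ?_
    push_cast; ring
  have := ENNReal.tsum_coe_ne_top_iff_summable.2 h3
  push_cast at this
  exact this

/-- The fractional commutator integral of a Morrey function vanishing on `cube x₀ (2 * ℓ)` is
controlled on `cube x₀ ℓ` by the oscillation of `b`. -/
theorem exists_lintegral_fractional_commutator_le {b : EuclideanSpace ℝ (Fin n) → 𝕜}
    (hb : MemBMO b) (hn : n ≠ 0) (hγn : γ < n) (hp : 1 < p) (hκ : κ < 1) (hr : 1 < r)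
    (hbump : FracBump γ p r w ν) (hw : IsWeight w) (hν : IsWeight ν) (hpos : ∀ᵐ x, 0 < w x)
    {η : ℝ≥0∞} (hη1 : η < 1) (hη : HalvingBound (wMeasure w) η) :
    ∃ C : ℝ≥0∞, C ≠ ∞ ∧ ∀ f : EuclideanSpace ℝ (Fin n) → 𝕜, AEStronglyMeasurable f volume →
      ∀ (x₀ : EuclideanSpace ℝ (Fin n)) (ℓ : ℝ), 0 < ℓ → ∀ x ∈ cube x₀ ℓ,
        ∫⁻ y, ‖b x - b y‖ₑ * ‖(cube x₀ (2 * ℓ))ᶜ.indicator f y‖ₑ / ‖x - y‖ₑ ^ ((n : ℝ) - γ) ≤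
          C * morreyNorm p κ ν w f * wMeasure w (cube x₀ ℓ) ^ ((κ - 1) / p)
            * (‖b x - ⨍ z in cube x₀ ℓ, b z‖ₑ + 1) := by
  obtain ⟨C, hCt, hC⟩ := exists_rpow_mul_setLIntegral_le (κ := κ) hb hp hr hbump hw hν hpos
  set e := (1 - κ) / p with he
  have he0 : 0 < e := div_pos (by linarith) (by linarith)
  set D := 2 ^ n * bmoSeminorm b with hD
  have hDt : D ≠ ∞ := ENNReal.mul_ne_top (by finiteness) hb.2.ne
  have hsum := tsum_natCast_mul_add_one_mul_pow_ne_top hDt (ENNReal.rpow_lt_one hη1 he0)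
  refine ⟨8 ^ ((n : ℝ) - γ) * (C * ∑' m : ℕ, (m * D + 1) * (η ^ e) ^ m), ?_,
    fun f hf x₀ ℓ hℓ x hx => ?_⟩
  · exact ENNReal.mul_ne_top (ENNReal.rpow_ne_top_of_nonneg (by linarith) (by simp))
      (ENNReal.mul_ne_top hCt hsum)
  set N := morreyNorm p κ ν w f
  set W : ℕ → ℝ≥0∞ := fun m => wMeasure w (cube x₀ (2 ^ m * ℓ)) with hW
  have hW0 : ∀ m, W m ≠ 0 := fun m => wMeasure_cube_ne_zero hw hpos x₀ (by positivity)
  have hWt : ∀ m, W m ≠ ∞ := fun m => wMeasure_cube_ne_top hw x₀ _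
  have hWzero : wMeasure w (cube x₀ ℓ) = W 0 := by simp [hW]
  set β := ‖b x - ⨍ z in cube x₀ ℓ, b z‖ₑ
  have hexp : (κ - 1) / p = -e := by rw [he]; ring
  rw [hexp, hWzero]
  -- Reverse doubling raised to the power `-e`. It gives decay because `e = (1 - κ) / p` is
  -- positive.
  have hdecay : ∀ m, W m ^ (-e) ≤ (η ^ e) ^ m * W 0 ^ (-e) := fun m => by
    have h1 : W 0 ≤ η ^ m * W m := by
      rw [← hWzero]; exact hη.measure_cube_le_pow_mul hn x₀ hℓ m
    have hcancel : ∀ k, W k ^ (-e) * W k ^ e = 1 := fun k => by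
      rw [← ENNReal.rpow_add _ _ (hW0 k) (hWt k), neg_add_cancel, ENNReal.rpow_zero]
    calc W m ^ (-e) = W m ^ (-e) * (W 0 ^ (-e) * W 0 ^ e) := by rw [hcancel, mul_one]
      _ ≤ W m ^ (-e) * (W 0 ^ (-e) * (η ^ m * W m) ^ e) := by gcongr
      _ = (W m ^ (-e) * W m ^ e) * ((η ^ m) ^ e * W 0 ^ (-e)) := by
          rw [ENNReal.mul_rpow_of_nonneg _ _ he0.le]; ring
      _ = _ := by
          rw [hcancel, one_mul, ← ENNReal.rpow_natCast_mul, mul_comm (m : ℝ) e,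
            ENNReal.rpow_mul_natCast]
  have hterm : ∀ m : ℕ, volume (cube x₀ (2 ^ m * ℓ)) ^ (γ / n - 1) *
        ∫⁻ y in cube x₀ (2 ^ m * ℓ), ‖b x - b y‖ₑ * ‖f y‖ₑ
      ≤ (C * N * W 0 ^ (-e) * (β + 1)) * ((m * D + 1) * (η ^ e) ^ m) := fun m => by
    set a := ⨍ z in cube x₀ (2 ^ m * ℓ), b z with ha
    -- The three-term triangle inequality is weakened to a product: this separates the dependence on
    -- `x`, `m` and `y`, and the added 1 in the last factor matches the local estimate.
    have hosc : ∀ y, ‖b x - b y‖ₑ ≤ ((β + 1) * (m * D + 1)) * (‖b y - a‖ₑ + 1) := fun y => by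
      have h1 : ‖b x - b y‖ₑ ≤ β + m * D + ‖b y - a‖ₑ := by
        have e1 : b x - b y = (b x - ⨍ z in cube x₀ ℓ, b z) + ((⨍ z in cube x₀ ℓ, b z) - a)
          + -(b y - a) := by ring
        rw [e1]
        refine (enorm_add_le _ _).trans ?_
        rw [enorm_neg]
        gcongr
        refine (enorm_add_le _ _).trans ?_
        gcongr
        exact enorm_setAverage_sub_setAverage_dilate_le hb.1 x₀ hℓ m
      refine h1.trans ?_
      have e2 : ((β + 1) * (m * D + 1)) * (‖b y - a‖ₑ + 1) = β + m * D + ‖b y - a‖ₑ +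
          (β * (m * D) + β * (m * D) * ‖b y - a‖ₑ + β * ‖b y - a‖ₑ + m * D * ‖b y - a‖ₑ + 1) := by
        ring
      rw [e2]
      exact le_self_add
    have hlocal := hC f hf x₀ (2 ^ m * ℓ) (by positivity)
    rw [hexp] at hlocal
    have hfac : (β + 1) * (m * D + 1) ≠ ∞ := by simp only [β]; finiteness
    calc _ ≤ volume (cube x₀ (2 ^ m * ℓ)) ^ (γ / n - 1) * ∫⁻ y in cube x₀ (2 ^ m * ℓ),
            ((β + 1) * (m * D + 1)) * ((‖b y - a‖ₑ + 1) * ‖f y‖ₑ) := by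
          refine mul_le_mul_right (lintegral_mono fun y => ?_) _
          rw [← mul_assoc]
          exact mul_le_mul_left (hosc y) _
      _ = ((β + 1) * (m * D + 1)) * (volume (cube x₀ (2 ^ m * ℓ)) ^ (γ / n - 1) *
            ∫⁻ y in cube x₀ (2 ^ m * ℓ), (‖b y - a‖ₑ + 1) * ‖f y‖ₑ) := by
          rw [lintegral_const_mul' _ _ hfac]; ring
      _ ≤ ((β + 1) * (m * D + 1)) * (C * N * W m ^ (-e)) := by gcongr
      _ ≤ ((β + 1) * (m * D + 1)) * (C * N * ((η ^ e) ^ m * W 0 ^ (-e))) := by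
          gcongr; exact hdecay m
      _ = _ := by ring
  calc _ ≤ _ := lintegral_fractional_indicator_compl_cube_le hn hγn hb.1.aestronglyMeasurable hf
        x₀ hℓ hx
    _ ≤ 8 ^ ((n : ℝ) - γ) *
        ∑' m : ℕ, (C * N * W 0 ^ (-e) * (β + 1)) * ((m * D + 1) * (η ^ e) ^ m) := by
        exact mul_le_mul_right (ENNReal.tsum_le_tsum hterm) _
    _ = _ := by rw [ENNReal.tsum_mul_left]; ring

end Tail

/-! ### Restriction in Morrey spaces and bounds for the weak norm. -/

section WeakMorrey

variable {n : ℕ} {𝕜 : Type*} [RCLike 𝕜] {p κ : ℝ} {w ν : EuclideanSpace ℝ (Fin n) → ℝ}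

theorem enorm_indicator_le (S : Set (EuclideanSpace ℝ (Fin n))) (f : EuclideanSpace ℝ (Fin n) → 𝕜)
    (y : EuclideanSpace ℝ (Fin n)) : ‖S.indicator f y‖ₑ ≤ ‖f y‖ₑ := by
  rw [enorm_indicator_eq_indicator_enorm]
  exact indicator_le_self _ _ _

theorem MemMorrey.indicator (hp : 0 ≤ p) {f : EuclideanSpace ℝ (Fin n) → 𝕜}
    (hf : MemMorrey p κ ν w f) {S : Set (EuclideanSpace ℝ (Fin n))} (hS : MeasurableSet S) :
    MemMorrey p κ ν w (S.indicator f) where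
  aestronglyMeasurable := hf.aestronglyMeasurable.indicator hS
  locally_lt_top K hK := (hf.locally_lt_top K hK).trans_le' <| by
    gcongr with y
    exact enorm_indicator_le S f y
  norm_lt_top := hf.norm_lt_top.trans_le' <| by
    unfold morreyNorm
    gcongr with x ℓ hℓ y
    exact enorm_indicator_le S f y

theorem weakMorreyNorm_le (hp : 0 < p) (hw : IsWeight w) (hpos : ∀ᵐ x, 0 < w x)
    {g : EuclideanSpace ℝ (Fin n) → 𝕜} {K N : ℝ≥0∞}
    (h : ∀ (x : EuclideanSpace ℝ (Fin n)) (ℓ : ℝ), 0 < ℓ → ∀ σ : ℝ, 0 < σ →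
      ENNReal.ofReal σ ^ p * wMeasure w {y | y ∈ cube x ℓ ∧ σ < ‖g y‖}
        ≤ K * N ^ p * wMeasure w (cube x ℓ) ^ κ) :
    weakMorreyNorm p κ w g ≤ K ^ (1 / p) * N := by
  refine iSup_le fun x => iSup_le fun ℓ => iSup_le fun hℓ => iSup_le fun σ => iSup_le fun hσ => ?_
  have hp1 : 0 ≤ 1 / p := by positivity
  have hW0 := wMeasure_cube_ne_zero hw hpos x hℓ
  have hWt := wMeasure_cube_ne_top hw x ℓ
  have h1 := ENNReal.rpow_le_rpow (h x ℓ hℓ σ hσ) hp1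
  rw [ENNReal.mul_rpow_of_nonneg _ _ hp1, ENNReal.mul_rpow_of_nonneg _ _ hp1,
    ENNReal.mul_rpow_of_nonneg _ _ hp1, ← ENNReal.rpow_mul, ← ENNReal.rpow_mul, ← ENNReal.rpow_mul,
    mul_one_div_cancel hp.ne', ENNReal.rpow_one, ENNReal.rpow_one, mul_one_div] at h1
  rw [mul_assoc, mul_comm, ← div_eq_mul_inv]
  refine ENNReal.div_le_of_le_mul (h1.trans_eq ?_)
  rfl

theorem weakMorreyNorm_of_ae_eq_zero (hp : 0 < p) (hw0 : ∀ᵐ x, w x = 0)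
    (g : EuclideanSpace ℝ (Fin n) → 𝕜) : weakMorreyNorm p κ w g = 0 := by
  have : wMeasure w = 0 := by
    unfold wMeasure
    rw [withDensity_congr_ae (g := 0) (by filter_upwards [hw0] with x hx; simp [hx]),
      withDensity_zero]
  simp [weakMorreyNorm, this, hp]

end WeakMorrey

end WeightedMorrey

/-! ### The boundedness theorem. -/

theorem theorem1p4 {𝕜 : Type*} [RCLike 𝕜] (n : ℕ) (p κ γ : ℝ)
    (hp : 1 < p) (hκ0 : 0 < κ) (hκ1 : κ < 1) (hγ0 : 0 < γ) (hγn : γ < n)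
    (b : EuclideanSpace ℝ (Fin n) → 𝕜) (hb : MemBMO b)
    (w ν : EuclideanSpace ℝ (Fin n) → ℝ) (hw : IsWeight w) (hν : IsWeight ν)
    (hbump : ∃ r : ℝ, 1 < r ∧ FracBump γ p r w ν)
    (hwA : MemAInfty w)
    (D : Submodule 𝕜 (EuclideanSpace ℝ (Fin n) → 𝕜))
    (hD : ∀ f : EuclideanSpace ℝ (Fin n) → 𝕜, MemMorrey p κ ν w f → f ∈ D)
    (T : (EuclideanSpace ℝ (Fin n) → 𝕜) → EuclideanSpace ℝ (Fin n) → 𝕜)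
    (hT : IsSublinearOn D T)
    (hsize : FracCommutatorSize γ b T
      {f | f ∈ D ∧ ((Integrable f volume ∧ HasCompactSupport f) ∨ MemMorrey p κ ν w f)})
    (hweak : WeakTypeOn p w ν D T) :
    ∃ C : ℝ≥0, ∀ f : EuclideanSpace ℝ (Fin n) → 𝕜, MemMorrey p κ ν w f →
      MemWeakMorrey p κ w (T f) ∧
        weakMorreyNorm p κ w (T f) ≤ C * morreyNorm p κ ν w f := by
  have hp0 : 0 < p := by linarith
  have hn : n ≠ 0 := by
    rintro rfl
    simp only [Nat.cast_zero] at hγn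
    linarith
  suffices h : ∃ C : ℝ≥0∞, C ≠ ∞ ∧ ∀ f : EuclideanSpace ℝ (Fin n) → 𝕜, MemMorrey p κ ν w f →
      weakMorreyNorm p κ w (T f) ≤ C * morreyNorm p κ ν w f by
    obtain ⟨C, hCt, hC⟩ := h
    lift C to ℝ≥0 using hCt
    exact ⟨C, fun f hf => ⟨⟨hT.aestronglyMeasurable f (hD f hf),
      (hC f hf).trans_lt (ENNReal.mul_lt_top ENNReal.coe_lt_top hf.norm_lt_top)⟩, hC f hf⟩⟩
  obtain ⟨q, hq, hwq⟩ := hwA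
  rcases hwq.ae_eq_zero_or_ae_pos hq with hw0 | hpos
  · exact ⟨0, ENNReal.zero_ne_top, fun f _ => by
      rw [weakMorreyNorm_of_ae_eq_zero hp0 hw0]; exact zero_le⟩
  obtain ⟨r, hr, hbump⟩ := hbump
  obtain ⟨η, hη1, hη⟩ := hwq.exists_halvingBound hq hpos
  obtain ⟨Cd, hCdt, hCd⟩ := hwq.exists_wMeasure_cube_two_mul_le hq hpos
  obtain ⟨Ct, hCtt, hCt⟩ := exists_lintegral_fractional_commutator_le (κ := κ) hb hn hγn hp hκ1 hr
    hbump hw hν hpos hη1 hη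
  obtain ⟨K, hKt, hK⟩ := hη.exists_lintegral_rpow_le hη1 wMeasure_absolutelyContinuous hb hp0
  obtain ⟨c, hc⟩ := hsize
  obtain ⟨Cw, hCw⟩ := hweak
  -- The factor `2 ^ p` pays for splitting the level `σ` into two halves; the two summands are the
  -- local and the far contributions.
  set K₀ : ℝ≥0∞ := 2 ^ p * (Cw * Cd ^ κ + (c * Ct) ^ p * K) with hK₀
  have hK₀t : K₀ ≠ ∞ := by
    have h1 : Cd ^ κ ≠ ∞ := ENNReal.rpow_ne_top_of_nonneg hκ0.le hCdt
    have h2 : (c * Ct) ^ p ≠ ∞ :=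
      ENNReal.rpow_ne_top_of_nonneg hp0.le (ENNReal.mul_ne_top ENNReal.coe_ne_top hCtt)
    have h3 : (2 : ℝ≥0∞) ^ p ≠ ∞ := ENNReal.rpow_ne_top_of_nonneg hp0.le (by simp)
    simp only [hK₀]
    finiteness
  refine ⟨K₀ ^ (1 / p), ENNReal.rpow_ne_top_of_nonneg (by positivity) hK₀t, fun f hf =>
    weakMorreyNorm_le hp0 hw hpos fun x ℓ hℓ σ hσ => ?_⟩
  set N := morreyNorm p κ ν w f
  have hW0 : wMeasure w (cube x ℓ) ≠ 0 := wMeasure_cube_ne_zero hw hpos x hℓ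
  have hWt : wMeasure w (cube x ℓ) ≠ ∞ := wMeasure_cube_ne_top hw x ℓ
  set W := wMeasure w (cube x ℓ)
  have hQm := measurableSet_cube x (2 * ℓ)
  set f₁ := (cube x (2 * ℓ)).indicator f with hf₁
  set f₂ := (cube x (2 * ℓ))ᶜ.indicator f with hf₂
  have hM₁ : MemMorrey p κ ν w f₁ := hf.indicator hp0.le hQm
  have hM₂ : MemMorrey p κ ν w f₂ := hf.indicator hp0.le hQm.compl
  have hadd := hT.add_le f₁ (hD _ hM₁) f₂ (hD _ hM₂)
  rw [hf₁, hf₂, indicator_self_add_compl, ← hf₁, ← hf₂] at hadd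
  set t : ℝ≥0∞ := ENNReal.ofReal (σ / 2) with ht
  have ht0 : t ≠ 0 := by simpa [ht] using hσ
  have htp0 : t ^ p ≠ 0 := (ENNReal.rpow_pos (pos_iff_ne_zero.2 ht0) ENNReal.ofReal_ne_top).ne'
  have htpt : t ^ p ≠ ∞ := ENNReal.rpow_ne_top_of_nonneg hp0.le ENNReal.ofReal_ne_top
  have hlocal : t ^ p * wMeasure w {y | σ / 2 < ‖T f₁ y‖} ≤ Cw * Cd ^ κ * N ^ p * W ^ κ := by
    calc _ ≤ t ^ p * (Cw / t ^ p * ∫⁻ y, ‖f₁ y‖ₑ ^ p * ENNReal.ofReal (ν y)) := by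
          gcongr; exact hCw f₁ (hD _ hM₁) (σ / 2) (by positivity)
      _ = Cw * ∫⁻ y, ‖f₁ y‖ₑ ^ p * ENNReal.ofReal (ν y) := by
          rw [← mul_assoc, ENNReal.mul_div_cancel htp0 htpt]
      _ = Cw * ∫⁻ y in cube x (2 * ℓ), ‖f y‖ₑ ^ p * ENNReal.ofReal (ν y) := by
          rw [← lintegral_indicator hQm]
          congr 2
          ext y
          by_cases hy : y ∈ cube x (2 * ℓ) <;> simp [hf₁, hy, hp0]
      _ ≤ Cw * (N ^ p * wMeasure w (cube x (2 * ℓ)) ^ κ) := by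
          gcongr; exact setLIntegral_le_morreyNorm hp0 hw hpos f x (by positivity)
      _ ≤ Cw * (N ^ p * (Cd * W) ^ κ) := by
          gcongr; exact hCd x ℓ hℓ
      _ = _ := by rw [ENNReal.mul_rpow_of_nonneg _ _ hκ0.le]; ring
  set G : EuclideanSpace ℝ (Fin n) → ℝ≥0∞ := fun y =>
    (c * Ct * N * W ^ ((κ - 1) / p)) * (‖b y - ⨍ z in cube x ℓ, b z‖ₑ + 1) with hG
  have hGm : AEMeasurable (fun y => G y ^ p) ((wMeasure w).restrict (cube x ℓ)) :=
    ((((hb.1.aestronglyMeasurable.sub aestronglyMeasurable_const).enorm.add_const 1).const_mul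
      _).pow_const p |>.mono_ac wMeasure_absolutelyContinuous).restrict
  -- `f₂` need be neither integrable nor compactly supported, so the size condition enters through
  -- its Morrey clause.
  have htail : ∀ᵐ y ∂wMeasure w, y ∈ cube x ℓ → ‖T f₂ y‖ₑ ≤ G y := by
    filter_upwards [wMeasure_absolutelyContinuous.ae_le (hc f₂ ⟨hD _ hM₂, Or.inr hM₂⟩)]
      with y hy hyQ
    refine (hy (notMem_tsupport_indicator_compl_cube f (by linarith) hyQ)).trans ?_
    refine (mul_le_mul_right (hCt f hf.aestronglyMeasurable x ℓ hℓ y hyQ) _).trans_eq ?_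
    simp only [hG]; ring
  -- Chebyshev with the `p`-th power of `G`: the weighted John–Nirenberg bound contributes `W`, and
  -- `W^(κ-1) W = W^κ`.
  have hglobal : t ^ p * wMeasure w {y | y ∈ cube x ℓ ∧ t ^ p ≤ G y ^ p}
      ≤ (c * Ct) ^ p * K * N ^ p * W ^ κ := by
    have hmarkov := mul_meas_ge_le_lintegral₀ hGm (t ^ p)
    rw [Measure.restrict_apply' (measurableSet_cube x ℓ), inter_comm] at hmarkov
    have hconst : (c * Ct * N * W ^ ((κ - 1) / p)) ^ p = (c * Ct) ^ p * N ^ p * W ^ (κ - 1) := by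
      rw [ENNReal.mul_rpow_of_nonneg _ _ hp0.le, ENNReal.mul_rpow_of_nonneg _ _ hp0.le,
        ← ENNReal.rpow_mul, div_mul_cancel₀ _ hp0.ne']
    calc _ ≤ ∫⁻ y in cube x ℓ, G y ^ p ∂wMeasure w := hmarkov
      _ = (c * Ct) ^ p * N ^ p * W ^ (κ - 1)
          * ∫⁻ y in cube x ℓ, (‖b y - ⨍ z in cube x ℓ, b z‖ₑ + 1) ^ p ∂wMeasure w := by
          have e : ∀ y, G y ^ p = (c * Ct) ^ p * N ^ p * W ^ (κ - 1)
              * (‖b y - ⨍ z in cube x ℓ, b z‖ₑ + 1) ^ p := fun y => by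
            rw [← hconst, ← ENNReal.mul_rpow_of_nonneg _ _ hp0.le]
          simp only [e]
          refine lintegral_const_mul' _ _ ?_
          exact ENNReal.mul_ne_top (ENNReal.mul_ne_top (ENNReal.rpow_ne_top_of_nonneg hp0.le
            (ENNReal.mul_ne_top ENNReal.coe_ne_top hCtt))
            (ENNReal.rpow_ne_top_of_nonneg hp0.le hf.norm_lt_top.ne))
            (ENNReal.rpow_ne_top_of_ne_zero hW0 hWt)
      _ ≤ (c * Ct) ^ p * N ^ p * W ^ (κ - 1) * (K * W) := by
          gcongr; exact hK x ℓ hℓ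
      _ = (c * Ct) ^ p * K * N ^ p * (W ^ (κ - 1) * W ^ (1 : ℝ)) := by
          rw [ENNReal.rpow_one]; ring
      _ = _ := by rw [← ENNReal.rpow_add _ _ hW0 hWt, sub_add_cancel]
  -- By sublinearity, where `|T f| > σ` but `|T f₁| ≤ σ / 2`, one has `|T f₂| ≥ σ / 2`, hence `G ≥
  -- t`.
  have hcover : {y | y ∈ cube x ℓ ∧ σ < ‖T f y‖} ≤ᵐ[wMeasure w]
      ({y | σ / 2 < ‖T f₁ y‖} ∪ {y | y ∈ cube x ℓ ∧ t ^ p ≤ G y ^ p} :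
        Set (EuclideanSpace ℝ (Fin n))) := by
    filter_upwards [wMeasure_absolutelyContinuous.ae_le hadd, htail] with y hy hyG ⟨hyQ, hyσ⟩
    rcases lt_or_ge (σ / 2) ‖T f₁ y‖ with h1 | h1
    · exact Or.inl h1
    · refine Or.inr ⟨hyQ, ENNReal.rpow_le_rpow (le_trans ?_ (hyG hyQ)) hp0.le⟩
      rw [ht, ← ofReal_norm]
      exact ENNReal.ofReal_le_ofReal (by linarith)
  have hσt : ENNReal.ofReal σ = 2 * t := by
    rw [ht, ← ENNReal.ofReal_ofNat, ← ENNReal.ofReal_mul (by norm_num)]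
    congr 1; ring
  calc _ ≤ ENNReal.ofReal σ ^ p * (wMeasure w {y | σ / 2 < ‖T f₁ y‖}
        + wMeasure w {y | y ∈ cube x ℓ ∧ t ^ p ≤ G y ^ p}) := by
        gcongr
        exact (measure_mono_ae hcover).trans (measure_union_le _ _)
    _ = 2 ^ p * (t ^ p * wMeasure w {y | σ / 2 < ‖T f₁ y‖}
        + t ^ p * wMeasure w {y | y ∈ cube x ℓ ∧ t ^ p ≤ G y ^ p}) := by
        rw [hσt, ENNReal.mul_rpow_of_nonneg _ _ hp0.le]; ring
    _ ≤ 2 ^ p * (Cw * Cd ^ κ * N ^ p * W ^ κ + (c * Ct) ^ p * K * N ^ p * W ^ κ) := by gcongr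
    _ = _ := by simp only [hK₀]; ring
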